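/- Let $R$ be a commutative unital ring, $\Gamma_0$ an $R$-module and $S\subset R$ a multiplicative set ($1\in S$, $SS\subset S$) containing no zero-divisors. Form the localizations $S^{-1}R$ and $N:=S^{-1}\Gamma_0$, regard $\Gamma_0$ as a subgroup of $N$ through its canonical image, let $G:=S^{-1}S$ be the group of fractions of elements of $S$ in the unit group of $S^{-1}R$, acting on $N$ by $\psi_g(n)=g^{-1}n$, and put $\Gamma:=N\rtimes_\psi G$. Assume that $R(s):=|s^{-1}\Gamma_0/\Gamma_0|<\infty$ for every $s\in S$. Then: (1) $(\Gamma,\Gamma_0)$ is a Hecke pair, that is, every double coset $\Gamma_0\gamma\Gamma_0$ is a finite union of left cosets of $\Gamma_0$. Denote by $\mathcal H(\Gamma,\Gamma_0)$ its Hecke *-algebra: the $\Gamma_0$-biinvariant functions $\Gamma\to\mathbb C$ supported in finitely many double cosets, with $f*g(\gamma)=\sum_{x\in\Gamma_0\backslash\Gamma}f(\gamma x^{-1})g(x)$ and $f^*(\gamma)=\overline{f(\gamma^{-1})}$; let $[\gamma]$ be the characteristic function of $\Gamma_0\gamma\Gamma_0$. (2) Write $e(x)$, $x\in N/\Gamma_0$,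 for the canonical unitaries of the group *-algebra $\mathbb C(N/\Gamma_0)$. There is an action $\alpha$ of $S$ by *-endomorphisms of $\mathbb C(N/\Gamma_0)$ with $$\alpha_s(e(x))=R(s)^{-1}\sum_{y\in N/\Gamma_0,\ sy=x}e(y),$$ and there is a *-isomorphism of $\mathbb C(N/\Gamma_0)\rtimes_\alpha S$ onto $\mathcal H(\Gamma,\Gamma_0)$ that maps $e(n+\Gamma_0)$ to $[n]$ for $n\in N$ and the canonical isometry $v_s$ to $R(s)^{-1/2}[s]$ for $s\in S$. Here $A\rtimes_\alpha S$ is the universal unital *-algebra generated by a unital *-homomorphism $\pi$ of $A$ and a representation $v$ of $S$ by isometries with $\pi(\alpha_s(a))=v_s\pi(a)v_s^*$. (3) The universal C*-enveloping algebra $C^*_u(\Gamma,\Gamma_0)$ of $\mathcal H(\Gamma,\Gamma_0)$ exists, there is an action of $S$ by *-endomorphisms of the group C*-algebra $C^*(N/\Gamma_0)$ given on the canonical unitaries by the formula in (2), and there is a *-isomorphism of the C*-algebraic semigroup crossed product $C^*(N/\Gamma_0)\rtimes_\alpha S$ (the C*-algebra generated by a universal covariant representation) onto $C^*_u(\Gamma,\Gamma_0)$,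 given on the canonical generators by the formulas in (2). -/

import Mathlib

/- ### Hecke pairs and Hecke *-algebras -/

/-- `(Γ, H)` is a Hecke pair: every double coset `H γ H` is a finite union of left cosets `x H`,
that is, its image in `Γ ⧸ H` is finite. -/
class IsHeckePair {Γ : Type*} [Group Γ] (H : Subgroup Γ) : Prop where
  finite_image : ∀ γ : Γ,
    ((fun x : Γ => (x : Γ ⧸ H)) '' (DoubleCoset.doubleCoset γ (H : Set Γ) (H : Set Γ))).Finite

/-- The set `H \ Γ` of right cosets `H γ`. -/
abbrev RightCosets {Γ : Type*} [Group Γ] (H : Subgroup Γ) : Type _ :=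
  Quotient (QuotientGroup.rightRel H)

/-- The `H`-biinvariant functions on `Γ` supported in finitely many double cosets. -/
def heckeFunctions {Γ : Type*} [Group Γ] (H : Subgroup Γ) : Submodule ℂ (Γ → ℂ) where
  carrier := {f | (∀ h ∈ H, ∀ γ, f (h * γ) = f γ) ∧ (∀ h ∈ H, ∀ γ, f (γ * h) = f γ) ∧
    ∃ T : Set Γ, T.Finite ∧
      Function.support f ⊆ ⋃ t ∈ T, DoubleCoset.doubleCoset t (H : Set Γ) (H : Set Γ)}
  zero_mem' := ⟨fun _ _ _ => rfl, fun _ _ _ => rfl, ∅, Set.finite_empty, by simp⟩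
  add_mem' := by
    rintro f g ⟨hf1, hf2, T, hT, hfT⟩ ⟨hg1, hg2, U, hU, hgU⟩
    refine ⟨fun h hh γ => by simp [hf1 h hh, hg1 h hh], fun h hh γ => by
      simp [hf2 h hh, hg2 h hh], T ∪ U, hT.union hU, ?_⟩
    rw [Set.biUnion_union]
    exact (Function.support_add f g).trans (Set.union_subset_union hfT hgU)
  smul_mem' := by
    rintro c f ⟨hf1, hf2, T, hT, hfT⟩
    refine ⟨fun h hh γ => by simp [hf1 h hh], fun h hh γ => by simp [hf2 h hh], T, hT, ?_⟩
    exact (Function.support_const_smul_subset c f).trans hfT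

/-- The convolution `(f * g)(γ) = ∑_{x ∈ H \ Γ} f (γ x⁻¹) g x`. -/
noncomputable def heckeConv {Γ : Type*} [Group Γ] (H : Subgroup Γ) (f g : Γ → ℂ) : Γ → ℂ :=
  fun γ => ∑ᶠ q : RightCosets H, f (γ * q.out⁻¹) * g q.out

section HeckeLemmas

variable {Γ : Type*} [Group Γ] {H : Subgroup Γ}

theorem rightCosets_out_mul_inv_mem (x : Γ) :
    x * (Quotient.out (Quotient.mk (QuotientGroup.rightRel H) x))⁻¹ ∈ H := by
  have h := Quotient.mk_out (s := QuotientGroup.rightRel H) x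
  exact QuotientGroup.rightRel_apply.mp h

theorem rightCosets_apply_out {β : Type*} {F : Γ → β} (hF : ∀ h ∈ H, ∀ γ, F (h * γ) = F γ)
    (x : Γ) : F (Quotient.out (Quotient.mk (QuotientGroup.rightRel H) x)) = F x := by
  have h := hF _ (rightCosets_out_mul_inv_mem (H := H) x)
    (Quotient.out (Quotient.mk (QuotientGroup.rightRel H) x))
  rw [inv_mul_cancel_right] at h
  exact h.symm

/-- Right translation by `b` on `H \ Γ`. -/
def rightCosetsMul (H : Subgroup Γ) (b : Γ) : RightCosets H ≃ RightCosets H :=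
  Quotient.congr (Equiv.mulRight b) (by
    intro x y
    simp [QuotientGroup.rightRel_apply, mul_assoc])

theorem rightCosetsMul_out {β : Type*} {F : Γ → β} (hF : ∀ h ∈ H, ∀ γ, F (h * γ) = F γ) (b : Γ)
    (q : RightCosets H) : F (rightCosetsMul H b q).out = F (q.out * b) := by
  conv_lhs => rw [← Quotient.out_eq q]
  exact rightCosets_apply_out hF _

theorem finsum_rightCosets_mul {F : Γ → ℂ} (hF : ∀ h ∈ H, ∀ γ, F (h * γ) = F γ) (b : Γ) :
    ∑ᶠ q : RightCosets H, F q.out = ∑ᶠ q : RightCosets H, F (q.out * b) := by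
  rw [← finsum_comp_equiv (rightCosetsMul H b)]
  exact finsum_congr fun q => rightCosetsMul_out hF b q

theorem heckeConv_left_inv {f g : Γ → ℂ} (hf : f ∈ heckeFunctions H) (hg : g ∈ heckeFunctions H)
    (γ : Γ) : ∀ h ∈ H, ∀ x, f (γ * (h * x)⁻¹) * g (h * x) = f (γ * x⁻¹) * g x := by
  intro h hh x
  rw [hg.1 h hh, mul_inv_rev, ← mul_assoc, hf.2.1 _ (H.inv_mem hh)]

theorem heckeFunctions_finite [hH : IsHeckePair H] {f : Γ → ℂ} (hf : f ∈ heckeFunctions H) :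
    {q : RightCosets H | f q.out ≠ 0}.Finite := by
  obtain ⟨-, -, T, hT, hfT⟩ := hf
  have key : ∀ t : Γ, {q : RightCosets H |
      q.out ∈ DoubleCoset.doubleCoset t (H : Set Γ) (H : Set Γ)}.Finite := by
    intro t
    refine Set.Finite.of_finite_image (f := fun q : RightCosets H => ((q.out⁻¹ : Γ) : Γ ⧸ H))
      ((hH.finite_image t⁻¹).subset ?_) ?_
    · rintro _ ⟨q, hq, rfl⟩
      refine ⟨q.out⁻¹, ?_, rfl⟩
      obtain ⟨a, ha, b, hb, hab⟩ := DoubleCoset.mem_doubleCoset.mp hq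
      exact DoubleCoset.mem_doubleCoset.mpr
        ⟨b⁻¹, H.inv_mem hb, a⁻¹, H.inv_mem ha, by rw [hab]; group⟩
    · intro q _ q' _ hqq
      have h1 := QuotientGroup.eq.mp hqq
      rw [inv_inv] at h1
      rw [← Quotient.out_eq q, ← Quotient.out_eq q']
      refine Quotient.sound (QuotientGroup.rightRel_apply.mpr ?_)
      simpa using H.inv_mem h1
  refine (hT.biUnion fun t _ => key t).subset fun q hq => ?_
  simpa using hfT hq

theorem heckeConv_support_finite [IsHeckePair H] (f : Γ → ℂ) {g : Γ → ℂ}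
    (hg : g ∈ heckeFunctions H) (γ : Γ) :
    (Function.support fun q : RightCosets H => f (γ * q.out⁻¹) * g q.out).Finite :=
  (heckeFunctions_finite hg).subset fun _ hq => right_ne_zero_of_mul hq

theorem heckeConv_mem [IsHeckePair H] {f g : Γ → ℂ} (hf : f ∈ heckeFunctions H)
    (hg : g ∈ heckeFunctions H) : heckeConv H f g ∈ heckeFunctions H := by
  refine ⟨fun h hh γ => ?_, fun h hh γ => ?_, ?_⟩
  · exact finsum_congr fun q => by rw [mul_assoc, hf.1 h hh]
  · change ∑ᶠ q : RightCosets H, _ = ∑ᶠ q : RightCosets H, _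
    rw [finsum_rightCosets_mul (F := fun x => f (γ * h * x⁻¹) * g x)
      (heckeConv_left_inv hf hg _) h]
    refine finsum_congr fun q => ?_
    rw [hg.2.1 h hh, mul_inv_rev]
    congr 2
    group
  · refine ⟨(fun p : RightCosets H × RightCosets H => p.1.out * p.2.out) ''
      ({q | f q.out ≠ 0} ×ˢ {q | g q.out ≠ 0}),
      ((heckeFunctions_finite hf).prod (heckeFunctions_finite hg)).image _, ?_⟩
    intro γ hγ
    obtain ⟨q, hq⟩ : ∃ q : RightCosets H, f (γ * q.out⁻¹) * g q.out ≠ 0 := by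
      by_contra hcon
      push Not at hcon
      exact hγ ((finsum_congr hcon).trans finsum_zero)
    have hq1 := left_ne_zero_of_mul hq
    have hq2 := right_ne_zero_of_mul hq
    rw [← rightCosets_apply_out hf.1] at hq1
    simp only [Set.mem_iUnion]
    refine ⟨_, ⟨(_, q), ⟨hq1, hq2⟩, rfl⟩, DoubleCoset.mem_doubleCoset.mpr
      ⟨_, rightCosets_out_mul_inv_mem (H := H) (γ * q.out⁻¹), 1, H.one_mem, ?_⟩⟩
    change γ = γ * q.out⁻¹ * (Quotient.out (Quotient.mk (QuotientGroup.rightRel H)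
      (γ * q.out⁻¹)))⁻¹ * (Quotient.out (Quotient.mk (QuotientGroup.rightRel H)
      (γ * q.out⁻¹)) * q.out) * 1
    group

theorem heckeConv_assoc [IsHeckePair H] {f g k : Γ → ℂ} (hf : f ∈ heckeFunctions H)
    (hg : g ∈ heckeFunctions H) (hk : k ∈ heckeFunctions H) :
    heckeConv H (heckeConv H f g) k = heckeConv H f (heckeConv H g k) := by
  funext γ
  have h1 : heckeConv H (heckeConv H f g) k γ = ∑ᶠ b : RightCosets H, ∑ᶠ c : RightCosets H,
      f (γ * c.out⁻¹) * (g (c.out * b.out⁻¹) * k b.out) := by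
    refine finsum_congr fun b => ?_
    unfold heckeConv
    rw [finsum_mul' _ _ (heckeConv_support_finite f hg _)]
    rw [finsum_rightCosets_mul (F := fun x => f (γ * b.out⁻¹ * x⁻¹) * g x * k b.out)
      (fun h hh x => by rw [heckeConv_left_inv hf hg _ h hh]) b.out⁻¹]
    refine finsum_congr fun c => ?_
    rw [mul_assoc]
    congr 2
    group
  have h2 : heckeConv H f (heckeConv H g k) γ = ∑ᶠ c : RightCosets H, ∑ᶠ b : RightCosets H,
      f (γ * c.out⁻¹) * (g (c.out * b.out⁻¹) * k b.out) := by
    refine finsum_congr fun c => ?_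
    unfold heckeConv
    rw [mul_finsum' _ _ (heckeConv_support_finite g hk _)]
  rw [h1, h2]
  have hfin : (Function.support fun p : RightCosets H × RightCosets H =>
      f (γ * p.2.out⁻¹) * (g (p.2.out * p.1.out⁻¹) * k p.1.out)).Finite := by
    have hB := heckeFunctions_finite hk
    have hC : ∀ b : RightCosets H, {c : RightCosets H | g (c.out * b.out⁻¹) ≠ 0}.Finite := by
      intro b
      refine Set.Finite.of_finite_image (f := rightCosetsMul H b.out⁻¹)
        ((heckeFunctions_finite hg).subset ?_) (rightCosetsMul H b.out⁻¹).injective.injOn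
      rintro _ ⟨c, hc, rfl⟩
      rw [Set.mem_ofPred_eq, rightCosetsMul_out hg.1]
      exact hc
    refine (hB.biUnion fun b _ => (hC b).image (fun c => (b, c))).subset ?_
    rintro ⟨b, c⟩ hbc
    have h3 := right_ne_zero_of_mul hbc
    simp only [Set.mem_iUnion]
    exact ⟨b, right_ne_zero_of_mul h3, c, left_ne_zero_of_mul h3, rfl⟩
  rw [← finsum_curry _ hfin, ← finsum_comp_equiv (Equiv.prodComm _ _)]
  exact finsum_curry (fun p : RightCosets H × RightCosets H =>
    f (γ * p.1.out⁻¹) * (g (p.1.out * p.2.out⁻¹) * k p.2.out))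
    ((hfin.preimage (Equiv.prodComm _ _).injective.injOn))

/-- The characteristic function of the double coset `H γ H`. -/
noncomputable def heckeChar (H : Subgroup Γ) (γ : Γ) : Γ → ℂ :=
  Set.indicator (DoubleCoset.doubleCoset γ (H : Set Γ) (H : Set Γ)) 1

theorem heckeChar_mem (γ : Γ) : heckeChar H γ ∈ heckeFunctions H := by
  refine ⟨fun h hh x => ?_, fun h hh x => ?_, {γ}, Set.finite_singleton γ, by
    simp [heckeChar, Set.support_indicator]⟩
  · have : h * x ∈ DoubleCoset.doubleCoset γ (H : Set Γ) (H : Set Γ) ↔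
        x ∈ DoubleCoset.doubleCoset γ (H : Set Γ) (H : Set Γ) := by
      simp only [DoubleCoset.mem_doubleCoset]
      constructor
      · rintro ⟨a, ha, b, hb, hab⟩
        exact ⟨h⁻¹ * a, H.mul_mem (H.inv_mem hh) ha, b, hb, by
          rw [mul_assoc, mul_assoc, ← mul_assoc a, ← hab]; group⟩
      · rintro ⟨a, ha, b, hb, rfl⟩
        exact ⟨h * a, H.mul_mem hh ha, b, hb, by group⟩
    by_cases hx : x ∈ DoubleCoset.doubleCoset γ (H : Set Γ) (H : Set Γ)
    · rw [heckeChar, Set.indicator_of_mem hx, Set.indicator_of_mem (this.2 hx)]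
      rfl
    · rw [heckeChar, Set.indicator_of_notMem hx, Set.indicator_of_notMem (mt this.1 hx)]
  · have : x * h ∈ DoubleCoset.doubleCoset γ (H : Set Γ) (H : Set Γ) ↔
        x ∈ DoubleCoset.doubleCoset γ (H : Set Γ) (H : Set Γ) := by
      simp only [DoubleCoset.mem_doubleCoset]
      constructor
      · rintro ⟨a, ha, b, hb, hab⟩
        exact ⟨a, ha, b * h⁻¹, H.mul_mem hb (H.inv_mem hh), by
          rw [← mul_assoc, ← hab]; group⟩
      · rintro ⟨a, ha, b, hb, rfl⟩
        exact ⟨a, ha, b * h, H.mul_mem hb hh, by group⟩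
    by_cases hx : x ∈ DoubleCoset.doubleCoset γ (H : Set Γ) (H : Set Γ)
    · rw [heckeChar, Set.indicator_of_mem hx, Set.indicator_of_mem (this.2 hx)]
      rfl
    · rw [heckeChar, Set.indicator_of_notMem hx, Set.indicator_of_notMem (mt this.1 hx)]

theorem heckeChar_one_apply (x : Γ) : heckeChar H 1 x = Set.indicator (H : Set Γ) 1 x := by
  have : DoubleCoset.doubleCoset (1 : Γ) (H : Set Γ) (H : Set Γ) = H := by
    ext y
    simp only [DoubleCoset.mem_doubleCoset]
    constructor
    · rintro ⟨a, ha, b, hb, rfl⟩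
      simpa using H.mul_mem ha hb
    · intro hy
      exact ⟨y, hy, 1, H.one_mem, by simp⟩
  rw [heckeChar, this]

theorem heckeConv_one_left {f : Γ → ℂ} (hf : f ∈ heckeFunctions H) :
    heckeConv H (heckeChar H 1) f = f := by
  funext γ
  unfold heckeConv
  rw [finsum_eq_single _ (Quotient.mk (QuotientGroup.rightRel H) γ)]
  · rw [heckeChar_one_apply, Set.indicator_of_mem (rightCosets_out_mul_inv_mem (H := H) γ),
      rightCosets_apply_out hf.1]
    simp
  · intro q hq
    rw [heckeChar_one_apply, Set.indicator_of_notMem, zero_mul]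
    intro h
    refine hq ?_
    rw [← Quotient.out_eq q]
    exact Quotient.sound (QuotientGroup.rightRel_apply.mpr h)

theorem heckeConv_one_right {f : Γ → ℂ} (hf : f ∈ heckeFunctions H) :
    heckeConv H f (heckeChar H 1) = f := by
  funext γ
  unfold heckeConv
  rw [finsum_eq_single _ (Quotient.mk (QuotientGroup.rightRel H) 1)]
  · have h := rightCosets_out_mul_inv_mem (H := H) 1
    rw [one_mul] at h
    have h' := H.inv_mem h
    rw [inv_inv] at h'
    rw [heckeChar_one_apply, Set.indicator_of_mem (show _ ∈ (H : Set Γ) from h'), hf.2.1 _ h]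
    simp
  · intro q hq
    rw [heckeChar_one_apply, Set.indicator_of_notMem, mul_zero]
    intro h
    refine hq ?_
    rw [← Quotient.out_eq q]
    refine Quotient.sound (QuotientGroup.rightRel_apply.mpr ?_)
    simpa using h

/-- The involution `f*(γ) = conj (f (γ⁻¹))`. -/
noncomputable def heckeStar (f : Γ → ℂ) : Γ → ℂ := fun γ => star (f γ⁻¹)

theorem heckeStar_mem {f : Γ → ℂ} (hf : f ∈ heckeFunctions H) :
    heckeStar f ∈ heckeFunctions H := by
  obtain ⟨hf1, hf2, T, hT, hfT⟩ := hf
  refine ⟨fun h hh γ => ?_, fun h hh γ => ?_, (fun t => t⁻¹) '' T, hT.image _, ?_⟩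
  · simp [heckeStar, hf2 _ (H.inv_mem hh)]
  · simp [heckeStar, hf1 _ (H.inv_mem hh)]
  · intro γ hγ
    have h0 : f γ⁻¹ ≠ 0 := fun h => hγ (by simp [heckeStar, h])
    have h1 := hfT h0
    simp only [Set.mem_iUnion] at h1
    obtain ⟨t, ht, h2⟩ := h1
    obtain ⟨a, ha, b, hb, hab⟩ := DoubleCoset.mem_doubleCoset.mp h2
    simp only [Set.mem_iUnion]
    refine ⟨t⁻¹, ⟨t, ht, rfl⟩, DoubleCoset.mem_doubleCoset.mpr
      ⟨b⁻¹, H.inv_mem hb, a⁻¹, H.inv_mem ha, ?_⟩⟩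
    rw [← inv_inv γ, hab]
    group

theorem heckeStar_conv [IsHeckePair H] {f g : Γ → ℂ} (hf : f ∈ heckeFunctions H)
    (hg : g ∈ heckeFunctions H) :
    heckeStar (heckeConv H f g) = heckeConv H (heckeStar g) (heckeStar f) := by
  funext γ
  have h1 : heckeConv H (heckeStar g) (heckeStar f) γ =
      ∑ᶠ q : RightCosets H, star (f (γ⁻¹ * q.out⁻¹) * g q.out) := by
    unfold heckeConv
    rw [finsum_rightCosets_mul (F := fun x => heckeStar g (γ * x⁻¹) * heckeStar f x)
      (heckeConv_left_inv (heckeStar_mem hg) (heckeStar_mem hf) γ) γ]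
    refine finsum_congr fun q => ?_
    rw [star_mul]
    simp [heckeStar]
  rw [h1]
  exact AddMonoidHom.map_finsum (starAddEquiv (R := ℂ)).toAddMonoidHom
    (heckeConv_support_finite f hg _)

end HeckeLemmas

/-- The Hecke *-algebra of the Hecke pair `(Γ, H)`: the `H`-biinvariant functions on `Γ` supported
in finitely many double cosets, with the convolution product and `f*(γ) = conj (f (γ⁻¹))`. -/
def HeckeAlgebra {Γ : Type*} [Group Γ] (H : Subgroup Γ) [IsHeckePair H] : Type _ :=
  ↥(heckeFunctions H)

namespace HeckeAlgebra

variable {Γ : Type*} [Group Γ] (H : Subgroup Γ) [IsHeckePair H]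

noncomputable instance : AddCommGroup (HeckeAlgebra H) :=
  inferInstanceAs (AddCommGroup ↥(heckeFunctions H))

noncomputable instance : Module ℂ (HeckeAlgebra H) :=
  inferInstanceAs (Module ℂ ↥(heckeFunctions H))

/-- The element `[γ]`: the characteristic function of the double coset of `γ`. -/
noncomputable def char (γ : Γ) : HeckeAlgebra H := ⟨heckeChar H γ, heckeChar_mem γ⟩

noncomputable instance : Ring (HeckeAlgebra H) where
  __ := (inferInstance : AddCommGroup (HeckeAlgebra H))
  mul f g := ⟨heckeConv H f.1 g.1, heckeConv_mem f.2 g.2⟩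
  one := char H 1
  mul_assoc f g k := Subtype.ext (heckeConv_assoc f.2 g.2 k.2)
  one_mul f := Subtype.ext (heckeConv_one_left f.2)
  mul_one f := Subtype.ext (heckeConv_one_right f.2)
  zero_mul f := Subtype.ext (by
    funext γ
    exact (finsum_congr fun q => zero_mul _).trans finsum_zero)
  mul_zero f := Subtype.ext (by
    funext γ
    exact (finsum_congr fun q => mul_zero _).trans finsum_zero)
  left_distrib f g k := Subtype.ext (by
    funext γ
    exact (finsum_congr fun q => mul_add _ _ _).trans
      (finsum_add_distrib (heckeConv_support_finite f.1 g.2 γ)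
        (heckeConv_support_finite f.1 k.2 γ)))
  right_distrib f g k := Subtype.ext (by
    funext γ
    exact (finsum_congr fun q => add_mul _ _ _).trans
      (finsum_add_distrib (heckeConv_support_finite f.1 k.2 γ)
        (heckeConv_support_finite g.1 k.2 γ)))

noncomputable instance : Algebra ℂ (HeckeAlgebra H) :=
  Algebra.ofModule
    (fun c f g => Subtype.ext (by
      funext γ
      refine Eq.trans (finsum_congr fun q => ?_)
        (smul_finsum' c (heckeConv_support_finite f.1 g.2 γ)).symm
      exact smul_mul_assoc c (f.1 (γ * q.out⁻¹)) (g.1 q.out)))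
    (fun c f g => Subtype.ext (by
      funext γ
      refine Eq.trans (finsum_congr fun q => ?_)
        (smul_finsum' c (heckeConv_support_finite f.1 g.2 γ)).symm
      exact mul_smul_comm c (f.1 (γ * q.out⁻¹)) (g.1 q.out)))

noncomputable instance : StarRing (HeckeAlgebra H) where
  star f := ⟨heckeStar f.1, heckeStar_mem f.2⟩
  star_involutive f := Subtype.ext (by
    funext γ
    simp [heckeStar])
  star_mul f g := Subtype.ext (heckeStar_conv f.2 g.2)
  star_add f g := Subtype.ext (by
    funext γ
    exact star_add (f.1 γ⁻¹) (g.1 γ⁻¹))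

instance : StarModule ℂ (HeckeAlgebra H) where
  star_smul c f := Subtype.ext (by
    funext γ
    exact star_smul c (f.1 γ⁻¹))

end HeckeAlgebra

/- ### *-algebras of monoids with involution, group algebras -/

section StarMonoidAlgebra

variable {W : Type*} [Monoid W] [StarMul W]

/-- The conjugate linear map on `ℂ[W]` that extends the involution of `W`. -/
noncomputable def monoidAlgebraStar (W : Type*) [Monoid W] [StarMul W] :
    MonoidAlgebra ℂ W →+ MonoidAlgebra ℂ W :=
  MonoidAlgebra.liftNC ((MonoidAlgebra.singleAddHom 1).comp (starAddEquiv (R := ℂ)).toAddMonoidHom)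
    (fun w => MonoidAlgebra.single (star w) 1)

theorem monoidAlgebraStar_single (w : W) (c : ℂ) :
    monoidAlgebraStar W (MonoidAlgebra.single w c) = MonoidAlgebra.single (star w) (star c) := by
  rw [monoidAlgebraStar, MonoidAlgebra.liftNC_single]
  change MonoidAlgebra.single 1 (star c) * _ = _
  rw [MonoidAlgebra.single_mul_single, one_mul, mul_one]

/-- The *-algebra structure of `ℂ[W]`, for a monoid `W` with involution. -/
noncomputable instance monoidAlgebraStarRing : StarRing (MonoidAlgebra ℂ W) where
  star := monoidAlgebraStar W
  star_involutive x := by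
    induction x using MonoidAlgebra.induction_linear with
    | zero => simp
    | add f g hf hg => simp only [map_add, hf, hg]
    | single w c => simp [monoidAlgebraStar_single]
  star_mul x y := by
    change monoidAlgebraStar W (x * y) = monoidAlgebraStar W y * monoidAlgebraStar W x
    induction x using MonoidAlgebra.induction_linear with
    | zero => simp
    | add f g hf hg => simp only [add_mul, mul_add, map_add, hf, hg]
    | single w c =>
      induction y using MonoidAlgebra.induction_linear with
      | zero => simp
      | add f g hf hg => simp only [add_mul, mul_add, map_add, hf, hg]
      | single w' c' =>
        simp [monoidAlgebraStar_single, MonoidAlgebra.single_mul_single, mul_comm]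
  star_add x y := map_add _ x y

instance monoidAlgebraStarModule : StarModule ℂ (MonoidAlgebra ℂ W) where
  star_smul c x := by
    change monoidAlgebraStar W (c • x) = star c • monoidAlgebraStar W x
    induction x using MonoidAlgebra.induction_linear with
    | zero => simp
    | add f g hf hg => simp only [smul_add, map_add, hf, hg]
    | single w d => simp [monoidAlgebraStar_single]

end StarMonoidAlgebra

/-- An additive group `Q`, written multiplicatively and with the involution `x ↦ x⁻¹`. -/
def StarGroup (Q : Type*) : Type _ := Multiplicative Q

/-- The element of the multiplicatively written group that corresponds to `x ∈ Q`. -/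
def StarGroup.of {Q : Type*} (x : Q) : StarGroup Q := Multiplicative.ofAdd x

instance (Q : Type*) [AddCommGroup Q] : CommGroup (StarGroup Q) :=
  inferInstanceAs (CommGroup (Multiplicative Q))

instance (Q : Type*) [AddCommGroup Q] : StarMul (StarGroup Q) where
  star x := x⁻¹
  star_involutive x := inv_inv x
  star_mul x y := mul_inv_rev x y

/-- The group *-algebra `ℂ(Q)` of an additively written abelian group `Q`. -/
abbrev GroupStarAlgebra (Q : Type*) [AddCommGroup Q] : Type _ := MonoidAlgebra ℂ (StarGroup Q)

/-- The canonical unitary of `ℂ(Q)` that corresponds to `x ∈ Q`. -/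
noncomputable def GroupStarAlgebra.e {Q : Type*} [AddCommGroup Q] (x : Q) : GroupStarAlgebra Q :=
  MonoidAlgebra.single (StarGroup.of x) 1

/- ### The *-algebraic semigroup crossed product -/

/-- The free monoid with involution on `X`: words in the letters `x` and `x*`, `x ∈ X`. -/
def FreeStarMonoid (X : Type*) : Type _ := FreeMonoid (X ⊕ X)

instance (X : Type*) : Monoid (FreeStarMonoid X) := inferInstanceAs (Monoid (FreeMonoid (X ⊕ X)))

instance (X : Type*) : StarMul (FreeStarMonoid X) where
  star w := FreeMonoid.map Sum.swap (FreeMonoid.reverse w)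
  star_involutive w := by
    change List.map Sum.swap (List.reverse (List.map Sum.swap (List.reverse
      (FreeMonoid.toList w)))) = FreeMonoid.toList w
    simp [List.map_reverse]
  star_mul w w' := by
    change List.map Sum.swap (List.reverse (FreeMonoid.toList w ++ FreeMonoid.toList w')) =
      List.map Sum.swap (List.reverse (FreeMonoid.toList w')) ++
        List.map Sum.swap (List.reverse (FreeMonoid.toList w))
    simp

/-- The letter `x` (for `Sum.inl x`) or `x*` (for `Sum.inr x`). -/
def FreeStarMonoid.letter {X : Type*} (y : X ⊕ X) : FreeStarMonoid X := FreeMonoid.of y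

theorem FreeStarMonoid.star_letter {X : Type*} (y : X ⊕ X) :
    star (FreeStarMonoid.letter y) = FreeStarMonoid.letter y.swap := rfl

theorem FreeStarMonoid.induction {X : Type*} {P : FreeStarMonoid X → Prop} (w : FreeStarMonoid X)
    (one : P 1) (mul : ∀ y w, P w → P (FreeStarMonoid.letter y * w)) : P w :=
  FreeMonoid.inductionOn' (motive := P) w one mul

/-- The generator `x` of the free unital *-algebra `ℂ[FreeStarMonoid X]` on `X`. -/
noncomputable def freeStarGen {X : Type*} (x : X) : MonoidAlgebra ℂ (FreeStarMonoid X) :=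
  MonoidAlgebra.single (FreeStarMonoid.letter (Sum.inl x)) 1

section CrossedProduct

variable {A : Type*} [Ring A] [StarRing A] [Algebra ℂ A] {S : Type*} [Monoid S]

/-- The relations, in the free unital *-algebra on `A ⊕ S`, of a covariant representation
`(π, V)` of `(A, S, α)`: `π` is a unital *-homomorphism, `V` is a representation of `S` by
isometries, and `π (α_s a) = V_s (π a) V_s*`. -/
inductive CovariantRel (α : S →* (A →⋆ₙₐ[ℂ] A)) : MonoidAlgebra ℂ (FreeStarMonoid (A ⊕ S)) →
    MonoidAlgebra ℂ (FreeStarMonoid (A ⊕ S)) → Prop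
  | add (a b : A) : CovariantRel α (freeStarGen (Sum.inl (a + b)))
      (freeStarGen (Sum.inl a) + freeStarGen (Sum.inl b))
  | smul (c : ℂ) (a : A) : CovariantRel α (freeStarGen (Sum.inl (c • a)))
      (c • freeStarGen (Sum.inl a))
  | mul (a b : A) : CovariantRel α (freeStarGen (Sum.inl (a * b)))
      (freeStarGen (Sum.inl a) * freeStarGen (Sum.inl b))
  | one : CovariantRel α (freeStarGen (Sum.inl 1)) 1
  | map_star (a : A) : CovariantRel α (freeStarGen (Sum.inl (star a)))
      (star (freeStarGen (Sum.inl a)))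
  | iso_mul (s t : S) : CovariantRel α (freeStarGen (Sum.inr (s * t)))
      (freeStarGen (Sum.inr s) * freeStarGen (Sum.inr t))
  | iso_one : CovariantRel α (freeStarGen (Sum.inr 1)) 1
  | isometry (s : S) : CovariantRel α (star (freeStarGen (Sum.inr s)) * freeStarGen (Sum.inr s)) 1
  | covariant (s : S) (a : A) : CovariantRel α (freeStarGen (Sum.inl (α s a)))
      (freeStarGen (Sum.inr s) * freeStarGen (Sum.inl a) * star (freeStarGen (Sum.inr s)))
  | star {x y} : CovariantRel α x y → CovariantRel α (star x) (star y)

/-- The *-algebraic semigroup crossed product `A ⋊_α S`: the universal unital *-algebra generated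
by a covariant representation of `(A, S, α)`. -/
def StarCrossedProduct (α : S →* (A →⋆ₙₐ[ℂ] A)) : Type _ := RingQuot (CovariantRel α)

namespace StarCrossedProduct

variable (α : S →* (A →⋆ₙₐ[ℂ] A))

noncomputable instance : Ring (StarCrossedProduct α) :=
  inferInstanceAs (Ring (RingQuot (CovariantRel α)))

noncomputable instance : Algebra ℂ (StarCrossedProduct α) :=
  inferInstanceAs (Algebra ℂ (RingQuot (CovariantRel α)))

noncomputable instance : StarRing (StarCrossedProduct α) :=
  RingQuot.starRing (CovariantRel α) (fun _ _ h => h.star)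

/-- The quotient map from the free unital *-algebra. -/
noncomputable def mk : MonoidAlgebra ℂ (FreeStarMonoid (A ⊕ S)) →ₐ[ℂ] StarCrossedProduct α :=
  RingQuot.mkAlgHom ℂ (CovariantRel α)

theorem mk_surjective : Function.Surjective (mk α) := RingQuot.mkAlgHom_surjective ℂ _

theorem mk_rel {x y : MonoidAlgebra ℂ (FreeStarMonoid (A ⊕ S))} (h : CovariantRel α x y) :
    mk α x = mk α y := RingQuot.mkAlgHom_rel ℂ h

theorem mk_star (x : MonoidAlgebra ℂ (FreeStarMonoid (A ⊕ S))) :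
    mk α (star x) = star (mk α x) := by
  simp only [mk, RingQuot.mkAlgHom_def, RingQuot.mkRingHom_def]
  rfl

instance : StarModule ℂ (StarCrossedProduct α) where
  star_smul c x := by
    obtain ⟨x, rfl⟩ := mk_surjective α x
    rw [← map_smul, ← mk_star, ← mk_star, star_smul, map_smul]

/-- The canonical unital *-homomorphism `A → A ⋊_α S`. -/
noncomputable def coeff : A →⋆ₐ[ℂ] StarCrossedProduct α where
  toFun a := mk α (freeStarGen (Sum.inl a))
  map_one' := (mk_rel α .one).trans (map_one _)
  map_mul' a b := (mk_rel α (.mul a b)).trans (map_mul _ _ _)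
  map_zero' := by
    have h := mk_rel α (.smul 0 (0 : A))
    rwa [zero_smul, zero_smul, map_zero] at h
  map_add' a b := (mk_rel α (.add a b)).trans (map_add _ _ _)
  commutes' c := by
    rw [Algebra.algebraMap_eq_smul_one, mk_rel α (.smul c 1), map_smul, mk_rel α .one, map_one,
      Algebra.algebraMap_eq_smul_one]
  map_star' a := (mk_rel α (.map_star a)).trans (mk_star α _)

/-- The canonical representation of `S` by isometries in `A ⋊_α S`. -/
noncomputable def iso : S →* StarCrossedProduct α where
  toFun s := mk α (freeStarGen (Sum.inr s))
  map_one' := (mk_rel α .iso_one).trans (map_one _)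
  map_mul' s t := (mk_rel α (.iso_mul s t)).trans (map_mul _ _ _)

theorem star_iso_mul_iso (s : S) : star (iso α s) * iso α s = 1 := by
  have h := mk_rel α (.isometry s)
  rwa [map_mul, mk_star, map_one] at h

end StarCrossedProduct

end CrossedProduct

/- ### Enveloping C*-algebras -/

/-- A C*-seminorm on a *-algebra `A`. -/
structure CStarSeminorm (A : Type*) [Ring A] [StarRing A] [Algebra ℂ A] extends
    Seminorm ℂ A where
  mul_le' : ∀ a b, toFun (a * b) ≤ toFun a * toFun b
  cstar' : ∀ a, toFun (star a * a) = toFun a * toFun a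

/-- The universal C*-enveloping algebra of the *-algebra `A` exists: the C*-seminorms of each
element (equivalently its norms in all *-representations) are bounded. -/
class HasCStarEnvelope (A : Type*) [Ring A] [StarRing A] [Algebra ℂ A] : Prop where
  bddAbove : ∀ a : A, BddAbove (Set.range fun p : CStarSeminorm A => p.toSeminorm a)

namespace CStarSeminorm

variable {A : Type*} [Ring A] [StarRing A] [Algebra ℂ A]

theorem toFun_nonneg (p : CStarSeminorm A) (a : A) : 0 ≤ p.toFun a := apply_nonneg p.toSeminorm a

theorem map_star (p : CStarSeminorm A) (a : A) : p.toSeminorm (star a) = p.toSeminorm a := by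
  have key : ∀ b, p.toSeminorm b ≤ p.toSeminorm (star b) := by
    intro b
    have h1 : p.toSeminorm b * p.toSeminorm b ≤ p.toSeminorm (star b) * p.toSeminorm b :=
      (p.cstar' b).symm.le.trans (p.mul_le' (star b) b)
    have h0 := apply_nonneg p.toSeminorm b
    rcases h0.eq_or_lt with h | h
    · rw [← h]
      exact apply_nonneg _ _
    · exact le_of_mul_le_mul_right h1 h
  refine le_antisymm ?_ (key a)
  simpa using key (star a)

noncomputable instance : Inhabited (CStarSeminorm A) :=
  ⟨{ (0 : Seminorm ℂ A) with
      mul_le' := fun _ _ => (mul_zero (0 : ℝ)).ge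
      cstar' := fun _ => (mul_zero (0 : ℝ)).symm }⟩

/-- The algebra `A` equipped with the seminorm `p`. -/
def Pre (_p : CStarSeminorm A) : Type _ := A

instance (p : CStarSeminorm A) : Ring p.Pre := inferInstanceAs (Ring A)
instance (p : CStarSeminorm A) : StarRing p.Pre := inferInstanceAs (StarRing A)
instance (p : CStarSeminorm A) : Algebra ℂ p.Pre := inferInstanceAs (Algebra ℂ A)
instance (p : CStarSeminorm A) [StarModule ℂ A] : StarModule ℂ p.Pre :=
  inferInstanceAs (StarModule ℂ A)

noncomputable instance (p : CStarSeminorm A) : SeminormedRing p.Pre where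
  __ := (inferInstance : Ring p.Pre)
  __ := p.toSeminorm.toAddGroupSeminorm.toSeminormedAddCommGroup
  norm_mul_le := p.mul_le'

noncomputable instance (p : CStarSeminorm A) : NormedAlgebra ℂ p.Pre where
  __ := (inferInstance : Algebra ℂ p.Pre)
  norm_smul_le c a := (map_smul_eq_mul p.toSeminorm c a).le

/-- The C*-algebra obtained from `(A, p)` by dividing out the null space of `p` and completing. -/
def Completion (p : CStarSeminorm A) : Type _ := UniformSpace.Completion p.Pre

section Completion

variable (p : CStarSeminorm A)

noncomputable instance : NormedRing p.Completion :=
  inferInstanceAs (NormedRing (UniformSpace.Completion p.Pre))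

instance : CompleteSpace p.Completion :=
  inferInstanceAs (CompleteSpace (UniformSpace.Completion p.Pre))

noncomputable instance : NormedAlgebra ℂ p.Completion where
  __ := (inferInstance : Algebra ℂ (UniformSpace.Completion p.Pre))
  norm_smul_le c x := (inferInstance : NormedSpace ℂ (UniformSpace.Completion p.Pre)).norm_smul_le c x

theorem isometry_star_pre : Isometry (star : p.Pre → p.Pre) :=
  AddMonoidHomClass.isometry_of_norm (starAddEquiv (R := p.Pre)) p.map_star

/-- The canonical map `A → Completion p`. -/
noncomputable def toCompletion (a : A) : p.Completion :=
  ((show p.Pre from a : p.Pre) : UniformSpace.Completion p.Pre)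

theorem norm_toCompletion (a : A) : ‖p.toCompletion a‖ = p.toSeminorm a :=
  UniformSpace.Completion.norm_coe (E := p.Pre) a

theorem denseRange_toCompletion : DenseRange p.toCompletion :=
  UniformSpace.Completion.denseRange_coe (α := p.Pre)

theorem toCompletion_add (a b : A) :
    p.toCompletion (a + b) = p.toCompletion a + p.toCompletion b :=
  UniformSpace.Completion.coe_add (α := p.Pre) a b

theorem toCompletion_mul (a b : A) :
    p.toCompletion (a * b) = p.toCompletion a * p.toCompletion b :=
  UniformSpace.Completion.coe_mul (α := p.Pre) a b

theorem toCompletion_smul (c : ℂ) (a : A) :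
    p.toCompletion (c • a) = c • p.toCompletion a :=
  UniformSpace.Completion.coe_smul (X := p.Pre) c a

/-- The extension of the involution to the completion, by continuity. -/
noncomputable instance : Star p.Completion where
  star := UniformSpace.Completion.map (star : p.Pre → p.Pre)

theorem continuous_star_completion : Continuous (star : p.Completion → p.Completion) :=
  UniformSpace.Completion.continuous_map

theorem toCompletion_star (a : A) : p.toCompletion (star a) = star (p.toCompletion a) :=
  (UniformSpace.Completion.map_coe p.isometry_star_pre.uniformContinuous a).symm

noncomputable instance : StarRing p.Completion where
  star_involutive x := by
    have hc := p.continuous_star_completion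
    refine p.denseRange_toCompletion.induction_on x
      (isClosed_eq (hc.comp hc) continuous_id) fun a => ?_
    rw [← toCompletion_star, ← toCompletion_star, star_star]
  star_mul x y := by
    have hc := p.continuous_star_completion
    refine p.denseRange_toCompletion.induction_on₂ (isClosed_eq ?_ ?_) (fun a b => ?_) x y
    · exact hc.comp (continuous_fst.mul continuous_snd)
    · exact (hc.comp continuous_snd).mul (hc.comp continuous_fst)
    · rw [← toCompletion_star, ← toCompletion_star, ← toCompletion_mul, ← toCompletion_mul,
        ← toCompletion_star, star_mul]
  star_add x y := by
    have hc := p.continuous_star_completion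
    refine p.denseRange_toCompletion.induction_on₂ (isClosed_eq ?_ ?_) (fun a b => ?_) x y
    · exact hc.comp (continuous_fst.add continuous_snd)
    · exact (hc.comp continuous_fst).add (hc.comp continuous_snd)
    · rw [← toCompletion_star, ← toCompletion_star, ← toCompletion_add, ← toCompletion_add,
        ← toCompletion_star, star_add]

variable [StarModule ℂ A]

noncomputable instance : CStarAlgebra p.Completion where
  norm_mul_self_le x := by
    have hc := p.continuous_star_completion
    refine p.denseRange_toCompletion.induction_on x (isClosed_le ?_ ?_) fun a => ?_
    · exact continuous_norm.mul continuous_norm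
    · exact continuous_norm.comp (hc.mul continuous_id)
    · rw [← toCompletion_star, ← toCompletion_mul, norm_toCompletion, norm_toCompletion]
      exact (p.cstar' a).ge
  star_smul c x := by
    have hc := p.continuous_star_completion
    refine p.denseRange_toCompletion.induction_on x (isClosed_eq ?_ ?_) fun a => ?_
    · exact hc.comp (continuous_const_smul (T := p.Completion) c)
    · exact hc.const_smul (M := ℂ) (star c)
    · rw [← toCompletion_star, ← toCompletion_smul, ← toCompletion_smul, ← toCompletion_star,
        star_smul]

/-- The canonical *-homomorphism `A → Completion p`. -/
noncomputable def toCompletionHom : A →⋆ₐ[ℂ] p.Completion where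
  toFun := p.toCompletion
  map_one' := UniformSpace.Completion.coe_one p.Pre
  map_mul' := p.toCompletion_mul
  map_zero' := UniformSpace.Completion.coe_zero
  map_add' := p.toCompletion_add
  commutes' c := by
    rw [Algebra.algebraMap_eq_smul_one, Algebra.algebraMap_eq_smul_one, toCompletion_smul]
    congr 1
  map_star' := p.toCompletion_star

end Completion

/-- The greatest C*-seminorm on `A`: the supremum of all C*-seminorms. -/
noncomputable def sup (A : Type*) [Ring A] [StarRing A] [Algebra ℂ A] [h : HasCStarEnvelope A] :
    CStarSeminorm A where
  toFun a := ⨆ p : CStarSeminorm A, p.toSeminorm a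
  map_zero' := by simp
  add_le' a b := ciSup_le fun p => (map_add_le_add p.toSeminorm a b).trans
    (add_le_add (le_ciSup (h.bddAbove a) p) (le_ciSup (h.bddAbove b) p))
  neg' a := by simp
  smul' c a := by
    rw [Real.mul_iSup_of_nonneg (norm_nonneg c)]
    exact iSup_congr fun p => map_smul_eq_mul p.toSeminorm c a
  mul_le' a b := ciSup_le fun p => (p.mul_le' a b).trans
    (mul_le_mul (le_ciSup (h.bddAbove a) p) (le_ciSup (h.bddAbove b) p) (p.toFun_nonneg _)
      (Real.iSup_nonneg fun p => apply_nonneg p.toSeminorm a))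
  cstar' a := by
    refine le_antisymm (ciSup_le fun p => ?_) ?_
    · exact (p.cstar' a).le.trans (mul_self_le_mul_self (p.toFun_nonneg _)
        (le_ciSup (h.bddAbove a) p))
    · have h0 : 0 ≤ ⨆ p : CStarSeminorm A, p.toSeminorm (star a * a) :=
        Real.iSup_nonneg fun p => apply_nonneg p.toSeminorm _
      have h1 : (⨆ p : CStarSeminorm A, p.toSeminorm a) ≤
          √(⨆ p : CStarSeminorm A, p.toSeminorm (star a * a)) :=
        ciSup_le fun p => Real.le_sqrt_of_sq_le
          ((sq _).trans_le ((p.cstar' a).ge.trans (le_ciSup (h.bddAbove (star a * a)) p)))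
      have h2 := mul_self_le_mul_self
        (Real.iSup_nonneg fun p : CStarSeminorm A => apply_nonneg p.toSeminorm a) h1
      rwa [Real.mul_self_sqrt h0] at h2

end CStarSeminorm

/-- The universal C*-enveloping algebra of a *-algebra: its Hausdorff completion in the greatest
C*-seminorm. -/
noncomputable abbrev CStarEnvelope (A : Type*) [Ring A] [StarRing A] [Algebra ℂ A]
    [StarModule ℂ A] [HasCStarEnvelope A] : Type _ := (CStarSeminorm.sup A).Completion

/-- The canonical *-homomorphism of `A` to its enveloping C*-algebra. -/
noncomputable def CStarEnvelope.ofAlg (A : Type*) [Ring A] [StarRing A] [Algebra ℂ A]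
    [StarModule ℂ A] [HasCStarEnvelope A] : A →⋆ₐ[ℂ] CStarEnvelope A :=
  (CStarSeminorm.sup A).toCompletionHom

namespace CStarSeminorm

variable {A : Type*} [Ring A] [StarRing A] [Algebra ℂ A]

theorem bddAbove_add {a b : A} (ha : BddAbove (Set.range fun p : CStarSeminorm A => p.toSeminorm a))
    (hb : BddAbove (Set.range fun p : CStarSeminorm A => p.toSeminorm b)) :
    BddAbove (Set.range fun p : CStarSeminorm A => p.toSeminorm (a + b)) := by
  obtain ⟨C, hC⟩ := ha
  obtain ⟨D, hD⟩ := hb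
  refine ⟨C + D, ?_⟩
  rintro _ ⟨p, rfl⟩
  exact (map_add_le_add p.toSeminorm a b).trans (add_le_add (hC ⟨p, rfl⟩) (hD ⟨p, rfl⟩))

theorem bddAbove_smul (c : ℂ) {a : A}
    (ha : BddAbove (Set.range fun p : CStarSeminorm A => p.toSeminorm a)) :
    BddAbove (Set.range fun p : CStarSeminorm A => p.toSeminorm (c • a)) := by
  obtain ⟨C, hC⟩ := ha
  refine ⟨‖c‖ * C, ?_⟩
  rintro _ ⟨p, rfl⟩
  exact (map_smul_eq_mul p.toSeminorm c a).le.trans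
    (mul_le_mul_of_nonneg_left (hC ⟨p, rfl⟩) (norm_nonneg c))

theorem bddAbove_mul {a b : A} (ha : BddAbove (Set.range fun p : CStarSeminorm A => p.toSeminorm a))
    (hb : BddAbove (Set.range fun p : CStarSeminorm A => p.toSeminorm b)) :
    BddAbove (Set.range fun p : CStarSeminorm A => p.toSeminorm (a * b)) := by
  obtain ⟨C, hC⟩ := ha
  obtain ⟨D, hD⟩ := hb
  refine ⟨C * D, ?_⟩
  rintro _ ⟨p, rfl⟩
  exact (p.mul_le' a b).trans (mul_le_mul (hC ⟨p, rfl⟩) (hD ⟨p, rfl⟩) (p.toFun_nonneg _)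
    ((apply_nonneg _ _).trans (hC ⟨p, rfl⟩)))

theorem map_one_le (p : CStarSeminorm A) : p.toSeminorm 1 ≤ 1 := by
  have h : p.toSeminorm (star 1 * 1) = p.toSeminorm 1 * p.toSeminorm 1 := p.cstar' 1
  rw [star_one, one_mul] at h
  nlinarith [sq_nonneg (p.toSeminorm 1 - 1), apply_nonneg p.toSeminorm 1]

/-- Isometries have norm at most one in every C*-seminorm. -/
theorem bddAbove_isometry {v : A} (hv : star v * v = 1) :
    BddAbove (Set.range fun p : CStarSeminorm A => p.toSeminorm v) := by
  refine ⟨1, ?_⟩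
  rintro _ ⟨p, rfl⟩
  have h : p.toSeminorm (star v * v) = p.toSeminorm v * p.toSeminorm v := p.cstar' v
  rw [hv] at h
  have := p.map_one_le
  change p.toSeminorm v ≤ 1
  nlinarith [apply_nonneg p.toSeminorm v]

theorem bddAbove_star {a : A} (ha : BddAbove (Set.range fun p : CStarSeminorm A => p.toSeminorm a)) :
    BddAbove (Set.range fun p : CStarSeminorm A => p.toSeminorm (star a)) := by
  simpa only [map_star] using ha

end CStarSeminorm

instance (Q : Type*) [AddCommGroup Q] : HasCStarEnvelope (GroupStarAlgebra Q) where
  bddAbove x := by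
    induction x using MonoidAlgebra.induction_linear with
    | zero =>
      simp only [map_zero]
      exact ⟨0, by rintro _ ⟨p, rfl⟩; rfl⟩
    | add f g hf hg => exact CStarSeminorm.bddAbove_add hf hg
    | single w c =>
      have h : (MonoidAlgebra.single w c : GroupStarAlgebra Q) =
          c • MonoidAlgebra.single w 1 := by simp
      rw [h]
      refine CStarSeminorm.bddAbove_smul c (CStarSeminorm.bddAbove_isometry ?_)
      change monoidAlgebraStar _ _ * _ = _
      rw [monoidAlgebraStar_single, MonoidAlgebra.single_mul_single, star_one, one_mul,
        MonoidAlgebra.one_def]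
      congr 1
      exact inv_mul_cancel w

/-- The group C*-algebra `C*(Q)` of an additively written abelian group `Q`. -/
noncomputable abbrev GroupCStarAlgebra (Q : Type*) [AddCommGroup Q] : Type _ :=
  CStarEnvelope (GroupStarAlgebra Q)

/-- The canonical unitary of `C*(Q)` that corresponds to `x ∈ Q`. -/
noncomputable def GroupCStarAlgebra.e {Q : Type*} [AddCommGroup Q] (x : Q) : GroupCStarAlgebra Q :=
  CStarEnvelope.ofAlg (GroupStarAlgebra Q) (GroupStarAlgebra.e x)

section CStarCrossedProduct

variable {A : Type*} [CStarAlgebra A] {S : Type*} [Monoid S] (α : S →* (A →⋆ₙₐ[ℂ] A))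

/-- For a C*-algebra `A`, the crossed product `A ⋊_α S` has an enveloping C*-algebra, because it is
generated by isometries and a homomorphic image of `A`. -/
instance : HasCStarEnvelope (StarCrossedProduct α) where
  bddAbove x := by
    have hcoeff : ∀ a : A, BddAbove (Set.range fun p : CStarSeminorm (StarCrossedProduct α) =>
        p.toSeminorm (StarCrossedProduct.coeff α a)) := by
      intro a
      refine ⟨‖a‖, ?_⟩
      rintro _ ⟨p, rfl⟩
      have h := NonUnitalStarAlgHom.norm_apply_le (p.toCompletionHom.comp
        (StarCrossedProduct.coeff α)) a
      exact (p.norm_toCompletion _).symm.trans_le h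
    obtain ⟨x, rfl⟩ := StarCrossedProduct.mk_surjective α x
    induction x using MonoidAlgebra.induction_linear with
    | zero =>
      simp only [map_zero]
      exact ⟨0, by rintro _ ⟨p, rfl⟩; rfl⟩
    | add f g hf hg =>
      rw [map_add]
      exact CStarSeminorm.bddAbove_add hf hg
    | single w c =>
      have h : (MonoidAlgebra.single w c : MonoidAlgebra ℂ (FreeStarMonoid (A ⊕ S))) =
          c • MonoidAlgebra.single w 1 := by simp
      rw [h, map_smul]
      refine CStarSeminorm.bddAbove_smul c ?_
      have hgen : ∀ y : A ⊕ S, BddAbove (Set.range fun p : CStarSeminorm (StarCrossedProduct α) =>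
          p.toSeminorm (StarCrossedProduct.mk α (freeStarGen y))) := by
        rintro (a | s)
        · exact hcoeff a
        · exact CStarSeminorm.bddAbove_isometry (StarCrossedProduct.star_iso_mul_iso α s)
      clear h
      induction w using FreeStarMonoid.induction with
      | one =>
        rw [← MonoidAlgebra.one_def, map_one]
        exact CStarSeminorm.bddAbove_isometry (by rw [star_one, one_mul])
      | mul y w ih =>
        have h1 : (MonoidAlgebra.single (FreeStarMonoid.letter y * w) 1 :
            MonoidAlgebra ℂ (FreeStarMonoid (A ⊕ S))) =
            MonoidAlgebra.single (FreeStarMonoid.letter y) 1 * MonoidAlgebra.single w 1 := by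
          rw [MonoidAlgebra.single_mul_single, one_mul]
        rw [h1, map_mul]
        refine CStarSeminorm.bddAbove_mul ?_ ih
        rcases y with y | y
        · exact hgen y
        · have h3 : (MonoidAlgebra.single (FreeStarMonoid.letter (Sum.inr y)) 1 :
              MonoidAlgebra ℂ (FreeStarMonoid (A ⊕ S))) = star (freeStarGen y) := by
            change _ = monoidAlgebraStar _ _
            rw [freeStarGen, monoidAlgebraStar_single, star_one, FreeStarMonoid.star_letter]
            rfl
          rw [h3, StarCrossedProduct.mk_star]
          exact CStarSeminorm.bddAbove_star (hgen y)

/-- The semigroup crossed product C*-algebra `A ⋊_α S`: the C*-algebra generated by a universal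
covariant representation of `(A, S, α)`. -/
noncomputable abbrev CStarCrossedProduct : Type _ := CStarEnvelope (StarCrossedProduct α)

/-- The canonical unital *-homomorphism of `A` to the C*-algebra `A ⋊_α S`. -/
noncomputable def CStarCrossedProduct.coeff : A →⋆ₐ[ℂ] CStarCrossedProduct α :=
  (CStarEnvelope.ofAlg _).comp (StarCrossedProduct.coeff α)

/-- The canonical representation of `S` by isometries in the C*-algebra `A ⋊_α S`. -/
noncomputable def CStarCrossedProduct.iso (s : S) : CStarCrossedProduct α :=
  CStarEnvelope.ofAlg _ (StarCrossedProduct.iso α s)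

end CStarCrossedProduct

/- ### The Hecke pair attached to a module and a multiplicative set -/

section Localization

variable {R : Type*} [CommRing R] (S : Submonoid R) (M : Type*) [AddCommGroup M] [Module R M]

/-- The group `S⁻¹S` of the fractions `t / s`, `s, t ∈ S`, in the unit group of `S⁻¹R`. -/
def fractionGroup : Subgroup (Localization S)ˣ where
  carrier := {u | ∃ s t : S, (u : Localization S) = Localization.mk (t : R) s}
  one_mem' := ⟨1, 1, Localization.mk_one.symm⟩
  mul_mem' := by
    rintro _ _ ⟨s, t, h⟩ ⟨s', t', h'⟩
    exact ⟨s * s', t * t', by rw [Units.val_mul, h, h', Localization.mk_mul]; rfl⟩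
  inv_mem' := by
    rintro u ⟨s, t, h⟩
    refine ⟨t, s, Units.inv_eq_of_mul_eq_one_right ?_⟩
    rw [h, Localization.mk_mul, mul_comm (t : R)]
    exact Localization.mk_self (s * t)

/-- The image of `s ∈ S` in `S⁻¹S`. -/
noncomputable def toFractionGroup (s : S) : fractionGroup S :=
  ⟨(IsLocalization.map_units (Localization S) s).unit, 1, s, by
    rw [IsUnit.unit_spec, Localization.mk_one_eq_algebraMap]⟩

/-- The action `ψ_g n = g⁻¹ n` of `S⁻¹S` on `S⁻¹M`. -/
noncomputable def fractionAction :
    fractionGroup S →* MulAut (Multiplicative (LocalizedModule S M)) :=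
  (MulAutMultiplicative (LocalizedModule S M)).symm.toMonoidHom.comp
    ((DistribMulAction.toAddAut (Localization S)ˣ (LocalizedModule S M)).comp
      ((fractionGroup S).subtype.comp invMonoidHom))

/-- The group `S⁻¹M ⋊ S⁻¹S`. -/
abbrev FractionSemidirect : Type _ :=
  Multiplicative (LocalizedModule S M) ⋊[fractionAction S M] fractionGroup S

/-- The canonical image of `M` in `S⁻¹M`. -/
noncomputable def moduleImage : Submodule R (LocalizedModule S M) :=
  LinearMap.range (LocalizedModule.mkLinearMap S M)

/-- The quotient `S⁻¹M / M`. -/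
abbrev FractionQuotient : Type _ := LocalizedModule S M ⧸ moduleImage S M

/-- The class in `S⁻¹M / M` of an element of `S⁻¹M`. -/
noncomputable def fractionClass (n : LocalizedModule S M) : FractionQuotient S M := Submodule.Quotient.mk n

/-- The canonical image of `M` in `S⁻¹M ⋊ S⁻¹S`. -/
noncomputable def moduleSubgroup : Subgroup (FractionSemidirect S M) :=
  (AddSubgroup.toSubgroup (moduleImage S M).toAddSubgroup).map SemidirectProduct.inl

/-- The submodule `s⁻¹M` of `S⁻¹M`. -/
noncomputable def fracImage (s : S) : Submodule R (LocalizedModule S M) :=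
  (moduleImage S M).map (LocalizedModule.divBy s)

/-- The quotient `s⁻¹M / M`. -/
abbrev InvQuotient (s : S) : Type _ :=
  ↥(fracImage S M s) ⧸ (moduleImage S M).submoduleOf (fracImage S M s)

end Localization

/-! Write `H` for the image of Γ₀ and call x ∈ Γ good if x⁻¹Hx ⊆ H (`conjInto`). Then HxH = xH, and
convolution with [x] is a translation: ([x]f)(γ) = f(x⁻¹γ) and (f[x]*)(γ) = f(γx). Hence [x][y] =
[xy] for good x and y, and [x]*[x] is the number of right cosets in HxH times 1. The normalised
elements V_x are therefore isometries that represent the monoid of good elements, and (V_x f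
V_y*)(γ) is a constant times f(x⁻¹γy). This formula carries the algebraic part.

All (n,1) and all (0,s) with s ∈ S are good, and the number of right cosets for (0,s) is R(s)
(`rightIndex_denEmb`). The map e(n + Γ₀) ↦ [n] identifies ℂ(N/Γ₀) with the functions that live over
1 ∈ G (`coeffHom_injective`, `exists_coeffHom_eq`). Since G is commutative, f ↦ V_s f V_s* preserves
these functions, so α_s can be defined as the pull-back of this map. Multiplicativity is V_s*V_s =
1, the formula for α_s(e(x)) is read off pointwise, and covariance holds by construction. The
universal property then yields `toHecke`.

Surjectivity: every f is a finite sum of parts living over single elements g ∈ G. For g = s⁻¹t and f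
living over g, the function V_s f V_t* lives over 1, hence is some a ∈ ℂ(N/Γ₀), and f = V_s* a V_t.

Injectivity: as S is commutative, every element z of the crossed product is moved by some v_s into
the span of the elements a v_t (`exists_iso_mul_mem_analyticSpan`), and left multiplication by v_s
is injective. The image of a v_t lives over t ∈ G, and distinct t stay distinct in G because S
contains no zero-divisors. So the terms can be separated (`injective_of_graded`).

The C*-statement is formal. Unitaries and isometries have norm at most 1 in every C*-seminorm, so
the envelopes exist. The envelope of ℂ(N/Γ₀) ⋊ S and the C*-algebra C*(N/Γ₀) ⋊ S are universal for
the same data, which gives mutually inverse homomorphisms (`crossedProductEquiv`). -/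

namespace HeckeAlgebra

/-! ### Translations and isometries in a general Hecke algebra. -/

section Semigroup

variable {Γ : Type*} [Group Γ] {H : Subgroup Γ}

/-- The submonoid of the `x` with `x⁻¹ H x ⊆ H`, for which `H x H = x H`. -/
def conjInto (H : Subgroup Γ) : Submonoid Γ where
  carrier := {x | ∀ h ∈ H, x⁻¹ * h * x ∈ H}
  one_mem' h hh := by simpa using hh
  mul_mem' {x y} hx hy h hh := by
    have := hy _ (hx h hh)
    rwa [show (x * y)⁻¹ * h * (x * y) = y⁻¹ * (x⁻¹ * h * x) * y by group]

theorem mem_doubleCoset_iff {x : Γ} (hx : x ∈ conjInto H) (y : Γ) :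
    y ∈ DoubleCoset.doubleCoset x (H : Set Γ) (H : Set Γ) ↔ x⁻¹ * y ∈ H := by
  rw [DoubleCoset.mem_doubleCoset]
  constructor
  · rintro ⟨a, ha, b, hb, rfl⟩
    have := H.mul_mem (hx a ha) hb
    rwa [show x⁻¹ * (a * x * b) = x⁻¹ * a * x * b by group]
  · intro h
    exact ⟨1, H.one_mem, _, h, by group⟩

open Classical in
theorem heckeChar_apply {x : Γ} (hx : x ∈ conjInto H) (y : Γ) :
    heckeChar H x y = if x⁻¹ * y ∈ H then 1 else 0 := by
  rw [heckeChar, Set.indicator_apply]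
  simp only [mem_doubleCoset_iff hx, Pi.one_apply]

variable [IsHeckePair H]

@[ext]
theorem ext {f g : HeckeAlgebra H} (h : ∀ γ, f.1 γ = g.1 γ) : f = g := Subtype.ext (funext h)

theorem zero_apply (γ : Γ) : (0 : HeckeAlgebra H).1 γ = 0 := rfl

theorem add_apply (f g : HeckeAlgebra H) (γ : Γ) : (f + g).1 γ = f.1 γ + g.1 γ := rfl

theorem smul_apply (c : ℂ) (f : HeckeAlgebra H) (γ : Γ) : (c • f).1 γ = c * f.1 γ := rfl

theorem star_apply (f : HeckeAlgebra H) (γ : Γ) : (star f).1 γ = star (f.1 γ⁻¹) := rfl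

theorem mul_apply (f g : HeckeAlgebra H) (γ : Γ) :
    (f * g).1 γ = ∑ᶠ q : RightCosets H, f.1 (γ * q.out⁻¹) * g.1 q.out := rfl

theorem char_one : char H (1 : Γ) = 1 := rfl

theorem sum_apply {ι : Type*} (T : Finset ι) (f : ι → HeckeAlgebra H) (γ : Γ) :
    (∑ i ∈ T, f i).1 γ = ∑ i ∈ T, (f i).1 γ := by
  classical
  induction T using Finset.induction_on with
  | empty => rfl
  | insert a T ha ih => rw [Finset.sum_insert ha, Finset.sum_insert ha, add_apply, ih]

open Classical in
theorem char_apply {x : Γ} (hx : x ∈ conjInto H) (y : Γ) :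
    (char H x).1 y = if x⁻¹ * y ∈ H then 1 else 0 := heckeChar_apply hx y

/-- [x]* is supported on the single right coset Hx⁻¹, so the convolution sum has one term. The
summand is left `H`-invariant, which allows x⁻¹ itself as the representative. -/
theorem mul_star_char_apply {x : Γ} (hx : x ∈ conjInto H) (f : HeckeAlgebra H) (γ : Γ) :
    (f * star (char H x)).1 γ = f.1 (γ * x) := by
  rw [mul_apply, finsum_eq_single _ (Quotient.mk (QuotientGroup.rightRel H) x⁻¹)]
  · rw [rightCosets_apply_out (F := fun y => f.1 (γ * y⁻¹) * (star (char H x)).1 y)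
      (heckeConv_left_inv f.2 (star (char H x)).2 γ)]
    simp [star_apply, char_apply hx, H.one_mem]
  · intro q hq
    rw [star_apply, char_apply hx, if_neg, star_zero, mul_zero]
    intro h
    refine hq ?_
    rw [← Quotient.out_eq q]
    refine Quotient.sound (QuotientGroup.rightRel_apply.mpr ?_)
    simpa using h

/-- The adjoint of `mul_star_char_apply`: [x]f = (f*[x]*)*. -/
theorem char_mul_apply {x : Γ} (hx : x ∈ conjInto H) (f : HeckeAlgebra H) (γ : Γ) :
    (char H x * f).1 γ = f.1 (x⁻¹ * γ) := by
  rw [← star_star (char H x * f), star_mul, star_apply, mul_star_char_apply hx, star_apply,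
    star_star, mul_inv_rev, inv_inv]

theorem char_mul_char {x y : Γ} (hx : x ∈ conjInto H) (hy : y ∈ conjInto H) :
    char H x * char H y = char H (x * y) := by
  ext γ
  rw [char_mul_apply hx, char_apply hy, char_apply ((conjInto H).mul_mem hx hy), mul_inv_rev,
    mul_assoc]

/-- The number of right cosets of `H` in `H x H`. -/
noncomputable def rightIndex (H : Subgroup Γ) (x : Γ) : ℕ :=
  Nat.card {q : RightCosets H // q.out ∈ DoubleCoset.doubleCoset x (H : Set Γ) (H : Set Γ)}

theorem finite_rightCosets_doubleCoset (x : Γ) : {q : RightCosets H |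
    q.out ∈ DoubleCoset.doubleCoset x (H : Set Γ) (H : Set Γ)}.Finite := by
  refine (heckeFunctions_finite (heckeChar_mem (H := H) x)).subset fun q hq => ?_
  change heckeChar H x q.out ≠ 0
  rw [heckeChar, Set.indicator_of_mem (by exact hq)]
  exact one_ne_zero

theorem finsum_char (x : Γ) :
    ∑ᶠ q : RightCosets H, (char H x).1 q.out = rightIndex H x := by
  classical
  have hfin := finite_rightCosets_doubleCoset (H := H) x
  have h1 : ∑ᶠ q : RightCosets H, (char H x).1 q.out = ∑ᶠ q ∈ {q : RightCosets H |
      q.out ∈ DoubleCoset.doubleCoset x (H : Set Γ) (H : Set Γ)}, (1 : ℂ) := by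
    refine finsum_congr fun q => ?_
    change heckeChar H x q.out = _
    rw [finsum_eq_if, heckeChar, Set.indicator_apply]
    rfl
  rw [h1, finsum_mem_eq_finite_toFinset_sum _ hfin, Finset.sum_const, nsmul_eq_mul, mul_one,
    rightIndex]
  congr 1
  exact (Nat.card_eq_card_finite_toFinset hfin).symm

/-- For q ∈ xH, the element qγ⁻¹ lies in xH exactly if γ ∈ H. So the convolution sum vanishes off
`H` and counts the right cosets in HxH on `H`. -/
theorem star_char_mul_char {x : Γ} (hx : x ∈ conjInto H) :
    star (char H x) * char H x = (rightIndex H x : ℂ) • 1 := by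
  classical
  ext γ
  rw [mul_apply, smul_apply, ← char_one, char_apply (Submonoid.one_mem _), inv_one, one_mul,
    ← finsum_char, finsum_mul' _ _ (by
      refine (heckeFunctions_finite (heckeChar_mem (H := H) x)).subset fun q hq => hq)]
  refine finsum_congr fun q => ?_
  rw [star_apply, char_apply hx, char_apply hx, mul_inv_rev, inv_inv]
  by_cases h : x⁻¹ * q.out ∈ H
  · have h2 : x⁻¹ * (q.out * γ⁻¹) ∈ H ↔ γ ∈ H := by
      rw [← mul_assoc, H.mul_mem_cancel_left h, inv_mem_iff]
    simp [h, h2]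
  · simp [h]

theorem eq_of_smul_one {a b : ℂ} (h : a • (1 : HeckeAlgebra H) = b • 1) : a = b := by
  have := congrArg (fun f : HeckeAlgebra H => f.1 1) h
  simpa [smul_apply, ← char_one, char_apply (Submonoid.one_mem (conjInto H)), H.one_mem]
    using this

/-- The product ([x][y])*([x][y]) is computed twice: as [xy]*[xy], and by collapsing the inner
factor [x]*[x] to a scalar. -/
theorem rightIndex_mul {x y : Γ} (hx : x ∈ conjInto H) (hy : y ∈ conjInto H) :
    rightIndex H (x * y) = rightIndex H x * rightIndex H y := by
  have h := star_char_mul_char (H := H) ((conjInto H).mul_mem hx hy)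
  rw [← char_mul_char hx hy, star_mul, mul_assoc, ← mul_assoc (star (char H x)),
    star_char_mul_char hx, smul_mul_assoc, one_mul, mul_smul_comm, star_char_mul_char hy,
    smul_smul] at h
  exact_mod_cast (eq_of_smul_one h).symm

theorem rightIndex_one : rightIndex H (1 : Γ) = 1 := by
  have h := star_char_mul_char (H := H) (Submonoid.one_mem _)
  rw [char_one, star_one, one_mul, ← one_smul ℂ (1 : HeckeAlgebra H), smul_smul, mul_one] at h
  exact_mod_cast (eq_of_smul_one h).symm

theorem rightIndex_pos (x : Γ) : 0 < rightIndex H x := by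
  have := (finite_rightCosets_doubleCoset (H := H) x).to_subtype
  refine Nat.card_pos_iff.mpr ⟨⟨⟨Quotient.mk (QuotientGroup.rightRel H) x, ?_⟩⟩, this⟩
  have h := H.inv_mem (rightCosets_out_mul_inv_mem (H := H) x)
  exact DoubleCoset.mem_doubleCoset.mpr ⟨_, h, 1, H.one_mem, by group⟩

/-- The isometry `(H : x⁻¹ H x)^{-1/2} [x]`, for `x⁻¹ H x ⊆ H`. -/
noncomputable def charIsometry (H : Subgroup Γ) [IsHeckePair H] : conjInto H →* HeckeAlgebra H where
  toFun x := (((√(rightIndex H (x : Γ)))⁻¹ : ℝ) : ℂ) • char H x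
  map_one' := by simp [rightIndex_one, char_one]
  map_mul' x y := by
    rw [smul_mul_smul_comm, char_mul_char x.2 y.2, Submonoid.coe_mul, rightIndex_mul x.2 y.2]
    congr 1
    push_cast
    rw [Real.sqrt_mul (Nat.cast_nonneg _)]
    push_cast
    rw [mul_inv]

theorem star_charIsometry_mul (x : conjInto H) :
    star (charIsometry H x) * charIsometry H x = 1 := by
  change star ((((√(rightIndex H (x : Γ)))⁻¹ : ℝ) : ℂ) • char H x) *
    ((((√(rightIndex H (x : Γ)))⁻¹ : ℝ) : ℂ) • char H x) = 1
  have h0 : (rightIndex H (x : Γ) : ℝ) ≠ 0 := by exact_mod_cast (rightIndex_pos (H := H) _).ne'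
  rw [star_smul, smul_mul_smul_comm, star_char_mul_char x.2, smul_smul, Complex.star_def,
    Complex.conj_ofReal, ← Complex.ofReal_mul, ← mul_inv, Real.mul_self_sqrt (Nat.cast_nonneg _),
    ← Complex.ofReal_natCast, ← Complex.ofReal_mul, inv_mul_cancel₀ h0, Complex.ofReal_one,
    one_smul]

/-- The values of `V_x f V_y*`, where `V_x`, `V_y` are the isometries of `x`, `y`. -/
theorem charIsometry_conj_apply (x y : conjInto H) (f : HeckeAlgebra H) (γ : Γ) :
    (charIsometry H x * f * star (charIsometry H y)).1 γ =
      (((√(rightIndex H (x : Γ)))⁻¹ * (√(rightIndex H (y : Γ)))⁻¹ : ℝ) : ℂ) *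
        f.1 ((x : Γ)⁻¹ * γ * y) := by
  change (((((√(rightIndex H (x : Γ)))⁻¹ : ℝ) : ℂ) • char H x) * f *
    star ((((√(rightIndex H (y : Γ)))⁻¹ : ℝ) : ℂ) • char H y)).1 γ = _
  rw [star_smul, mul_smul_comm, smul_apply, mul_star_char_apply y.2, smul_mul_assoc, smul_apply,
    char_mul_apply x.2, Complex.star_def, Complex.conj_ofReal, Complex.ofReal_mul,
    mul_left_comm]
  simp only [mul_assoc]

end Semigroup

end HeckeAlgebra

/-! ### The universal property of the free unital *-algebra. -/

section FreeStar

variable {X B : Type*} [Ring B] [StarRing B] [Algebra ℂ B]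

/-- The monoid homomorphism on words that extends `f : X → B` and respects the involution. -/
def FreeStarMonoid.lift (f : X → B) : FreeStarMonoid X →* B where
  toFun w := FreeMonoid.lift (Sum.elim f fun x => star (f x)) w
  map_one' := map_one (FreeMonoid.lift (Sum.elim f fun x => star (f x)))
  map_mul' := map_mul (FreeMonoid.lift (Sum.elim f fun x => star (f x)))

/-- The homomorphism from the free unital *-algebra on `X` that extends `f : X → B`. -/
noncomputable def freeStarLift (f : X → B) : MonoidAlgebra ℂ (FreeStarMonoid X) →ₐ[ℂ] B :=
  MonoidAlgebra.lift ℂ B (FreeStarMonoid X) (FreeStarMonoid.lift f)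

theorem freeStarLift_single_letter (f : X → B) (y : X ⊕ X) :
    freeStarLift f (MonoidAlgebra.single (FreeStarMonoid.letter y) 1) =
      Sum.elim f (fun x => star (f x)) y := by
  rw [freeStarLift, MonoidAlgebra.lift_single, one_smul]
  exact FreeMonoid.lift_eval_of _ _

theorem freeStarLift_gen (f : X → B) (x : X) : freeStarLift f (freeStarGen x) = f x :=
  freeStarLift_single_letter f (Sum.inl x)

/-- Induction on elements of the free unital *-algebra by left multiplication with generators. -/
theorem freeStar_induction {P : MonoidAlgebra ℂ (FreeStarMonoid X) → Prop}
    (x : MonoidAlgebra ℂ (FreeStarMonoid X)) (one : P 1) (add : ∀ x y, P x → P y → P (x + y))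
    (smul : ∀ (c : ℂ) x, P x → P (c • x)) (gen : ∀ y x, P x → P (freeStarGen y * x))
    (star_gen : ∀ y x, P x → P (star (freeStarGen y) * x)) : P x := by
  have hw : ∀ w : FreeStarMonoid X, P (MonoidAlgebra.single w 1) := by
    intro w
    induction w using FreeStarMonoid.induction with
    | one => exact one
    | mul y w ih =>
      rw [show (MonoidAlgebra.single (FreeStarMonoid.letter y * w) 1 :
          MonoidAlgebra ℂ (FreeStarMonoid X)) = MonoidAlgebra.single (FreeStarMonoid.letter y) 1 *
            MonoidAlgebra.single w 1 by rw [MonoidAlgebra.single_mul_single, one_mul]]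
      rcases y with y | y
      · exact gen y _ ih
      · have h : (MonoidAlgebra.single (FreeStarMonoid.letter (Sum.inr y)) 1 :
            MonoidAlgebra ℂ (FreeStarMonoid X)) = star (freeStarGen y) := by
          change _ = monoidAlgebraStar _ _
          rw [freeStarGen, monoidAlgebraStar_single, star_one, FreeStarMonoid.star_letter]
          rfl
        rw [h]
        exact star_gen y _ ih
  induction x using MonoidAlgebra.induction_linear with
  | zero => simpa using smul 0 1 one
  | add f g hf hg => exact add f g hf hg
  | single w c =>
    rw [show (MonoidAlgebra.single w c : MonoidAlgebra ℂ (FreeStarMonoid X)) =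
      c • MonoidAlgebra.single w 1 by simp]
    exact smul c _ (hw w)

theorem freeStarLift_star [StarModule ℂ B] (f : X → B) (x : MonoidAlgebra ℂ (FreeStarMonoid X)) :
    freeStarLift f (star x) = star (freeStarLift f x) := by
  have h : ∀ y : X, freeStarLift f (star (freeStarGen y)) = star (f y) := by
    intro y
    refine Eq.trans (congrArg _ ?_) (freeStarLift_single_letter f (Sum.inr y))
    change monoidAlgebraStar _ _ = _
    rw [freeStarGen, monoidAlgebraStar_single, star_one, FreeStarMonoid.star_letter]
    rfl
  induction x using freeStar_induction with
  | one => simp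
  | add x y hx hy => simp [hx, hy]
  | smul c x hx => simp [hx]
  | gen y x hx => rw [star_mul, map_mul, map_mul, star_mul, hx, h, freeStarLift_gen]
  | star_gen y x hx =>
    rw [star_mul, map_mul, map_mul, star_mul, hx, h, star_star, star_star, freeStarLift_gen]

end FreeStar

/-! ### The universal property of the *-algebraic crossed product. -/

namespace StarCrossedProduct

variable {A : Type*} [Ring A] [StarRing A] [Algebra ℂ A]

section Monoid

variable {S : Type*} [Monoid S] (α : S →* (A →⋆ₙₐ[ℂ] A))

theorem covariance (s : S) (a : A) :
    coeff α (α s a) = iso α s * coeff α a * star (iso α s) := by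
  have h := mk_rel α (.covariant s a)
  rwa [map_mul, map_mul, mk_star] at h

/-- Induction on elements of the crossed product by left multiplication with generators. -/
theorem induction_left {P : StarCrossedProduct α → Prop} (z : StarCrossedProduct α) (one : P 1)
    (add : ∀ x y, P x → P y → P (x + y)) (coeff_mul : ∀ a x, P x → P (coeff α a * x))
    (iso_mul : ∀ s x, P x → P (iso α s * x))
    (star_iso_mul : ∀ s x, P x → P (star (iso α s) * x)) : P z := by
  obtain ⟨x, rfl⟩ := mk_surjective α z
  induction x using freeStar_induction with
  | one => rwa [map_one]
  | add x y hx hy => rw [map_add]; exact add _ _ hx hy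
  | smul c x hx =>
    -- A scalar is absorbed into a coefficient, c • x = (c • 1) x, so the induction principle needs
    -- no case for scalars.
    rw [map_smul, ← one_mul (mk α x), ← smul_mul_assoc, ← map_one (coeff α), ← map_smul]
    exact coeff_mul _ _ hx
  | gen y x hx =>
    rw [map_mul]
    rcases y with a | s
    · exact coeff_mul a _ hx
    · exact iso_mul s _ hx
  | star_gen y x hx =>
    rw [map_mul, mk_star]
    rcases y with a | s
    · rw [show star (mk α (freeStarGen (Sum.inl a))) = coeff α (star a) from
        (map_star (coeff α) a).symm]
      exact coeff_mul _ _ hx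
    · exact star_iso_mul s _ hx

variable {B : Type*} [Ring B] [StarRing B] [Algebra ℂ B]

variable {α} in
theorem hom_ext {φ ψ : StarCrossedProduct α →⋆ₐ[ℂ] B} (hc : ∀ a, φ (coeff α a) = ψ (coeff α a))
    (hi : ∀ s, φ (iso α s) = ψ (iso α s)) : φ = ψ := by
  ext z
  induction z using induction_left with
  | one => rw [map_one, map_one]
  | add x y hx hy => rw [map_add, map_add, hx, hy]
  | coeff_mul a x hx => rw [map_mul, map_mul, hc, hx]
  | iso_mul s x hx => rw [map_mul, map_mul, hi, hx]
  | star_iso_mul s x hx => rw [map_mul, map_mul, map_star, map_star, hi, hx]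

variable [StarModule ℂ B]

/-- The universal property of the crossed product. -/
noncomputable def lift (π : A →⋆ₐ[ℂ] B) (v : S →* B) (hv : ∀ s, star (v s) * v s = 1)
    (hπ : ∀ s a, π (α s a) = v s * π a * star (v s)) : StarCrossedProduct α →⋆ₐ[ℂ] B where
  __ := RingQuot.liftAlgHom ℂ (s := CovariantRel α) ⟨freeStarLift (Sum.elim π v), by
    intro x y h
    induction h with
    | add a b => simp [freeStarLift_gen]
    | smul c a => simp [freeStarLift_gen]
    | mul a b => simp [freeStarLift_gen]
    | one => simp [freeStarLift_gen]
    | map_star a => simp [freeStarLift_gen, freeStarLift_star, map_star]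
    | iso_mul s t => simp [freeStarLift_gen]
    | iso_one => simp [freeStarLift_gen]
    | isometry s => simp [freeStarLift_gen, freeStarLift_star, hv]
    | covariant s a => simp [freeStarLift_gen, freeStarLift_star, hπ]
    | star _ ih => rw [freeStarLift_star, freeStarLift_star, ih]⟩
  map_star' z := by
    obtain ⟨x, rfl⟩ := mk_surjective α z
    rw [← mk_star]
    change RingQuot.liftAlgHom ℂ _ (RingQuot.mkAlgHom ℂ _ _) =
      star (RingQuot.liftAlgHom ℂ _ (RingQuot.mkAlgHom ℂ _ _))
    rw [RingQuot.liftAlgHom_mkAlgHom_apply, RingQuot.liftAlgHom_mkAlgHom_apply, freeStarLift_star]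

variable {α} in
theorem lift_coeff {π : A →⋆ₐ[ℂ] B} {v : S →* B} (hv : ∀ s, star (v s) * v s = 1)
    (hπ : ∀ s a, π (α s a) = v s * π a * star (v s)) (a : A) :
    lift α π v hv hπ (coeff α a) = π a := by
  change RingQuot.liftAlgHom ℂ _ (RingQuot.mkAlgHom ℂ _ _) = _
  rw [RingQuot.liftAlgHom_mkAlgHom_apply, freeStarLift_gen]
  rfl

variable {α} in
theorem lift_iso {π : A →⋆ₐ[ℂ] B} {v : S →* B} (hv : ∀ s, star (v s) * v s = 1)
    (hπ : ∀ s a, π (α s a) = v s * π a * star (v s)) (s : S) :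
    lift α π v hv hπ (iso α s) = v s := by
  change RingQuot.liftAlgHom ℂ _ (RingQuot.mkAlgHom ℂ _ _) = _
  rw [RingQuot.liftAlgHom_mkAlgHom_apply, freeStarLift_gen]
  rfl

end Monoid

/-! ### Commutative semigroups: clearing adjoints, and a criterion for injectivity. -/

section CommMonoid

variable {S : Type*} [CommMonoid S] (α : S →* (A →⋆ₙₐ[ℂ] A))

/-- The span of the elements `a v_t`. -/
noncomputable def analyticSpan : Submodule ℂ (StarCrossedProduct α) :=
  Submodule.span ℂ {z | ∃ a t, z = coeff α a * iso α t}

theorem coeff_mul_mem_analyticSpan (a : A) {z : StarCrossedProduct α} (hz : z ∈ analyticSpan α) :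
    coeff α a * z ∈ analyticSpan α := by
  induction hz using Submodule.span_induction with
  | mem z hz =>
    obtain ⟨b, t, rfl⟩ := hz
    exact Submodule.subset_span ⟨a * b, t, by rw [map_mul, mul_assoc]⟩
  | zero => simp
  | add x y _ _ hx hy => rw [mul_add]; exact add_mem hx hy
  | smul c x _ hx => rw [mul_smul_comm]; exact Submodule.smul_mem _ c hx

/-- Covariance with the factor v_s* cancelled by v_s. It moves coefficients to the left of
isometries. -/
theorem iso_mul_coeff (s : S) (a : A) :
    iso α s * coeff α a = coeff α (α s a) * iso α s := by
  rw [covariance, mul_assoc, star_iso_mul_iso, mul_one]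

theorem iso_mul_mem_analyticSpan (s : S) {z : StarCrossedProduct α} (hz : z ∈ analyticSpan α) :
    iso α s * z ∈ analyticSpan α := by
  induction hz using Submodule.span_induction with
  | mem z hz =>
    obtain ⟨b, t, rfl⟩ := hz
    exact Submodule.subset_span ⟨α s b, s * t, by
      rw [← mul_assoc, iso_mul_coeff, mul_assoc, map_mul]⟩
  | zero => simp
  | add x y _ _ hx hy => rw [mul_add]; exact add_mem hx hy
  | smul c x _ hx => rw [mul_smul_comm]; exact Submodule.smul_mem _ c hx

/-- An analogue of a common denominator. Commutativity of S provides a common multiple for two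
summands and lets v_s pass v_r; a left factor v_r* is cleared by v_r at the cost of the coefficient
α_r(1) = v_r v_r*. -/
theorem exists_iso_mul_mem_analyticSpan (z : StarCrossedProduct α) :
    ∃ s, iso α s * z ∈ analyticSpan α := by
  induction z using induction_left with
  | one => exact ⟨1, Submodule.subset_span ⟨1, 1, by simp⟩⟩
  | add x y hx hy =>
    obtain ⟨s, hs⟩ := hx
    obtain ⟨t, ht⟩ := hy
    refine ⟨s * t, ?_⟩
    rw [mul_add]
    refine add_mem ?_ ?_
    · rw [mul_comm s t, map_mul, mul_assoc]
      exact iso_mul_mem_analyticSpan α t hs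
    · rw [map_mul, mul_assoc]
      exact iso_mul_mem_analyticSpan α s ht
  | coeff_mul a x hx =>
    obtain ⟨s, hs⟩ := hx
    refine ⟨s, ?_⟩
    rw [← mul_assoc, iso_mul_coeff, mul_assoc]
    exact coeff_mul_mem_analyticSpan α _ hs
  | iso_mul r x hx =>
    obtain ⟨s, hs⟩ := hx
    refine ⟨s, ?_⟩
    rw [← mul_assoc, ← map_mul, mul_comm, map_mul, mul_assoc]
    exact iso_mul_mem_analyticSpan α r hs
  | star_iso_mul r x hx =>
    obtain ⟨s, hs⟩ := hx
    refine ⟨s * r, ?_⟩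
    -- v_s v_r v_r* x = v_s α_r(1) x = α_s(α_r(1)) v_s x.
    have h : iso α (s * r) * (star (iso α r) * x) =
        coeff α (α s (α r 1)) * (iso α s * x) := by
      rw [← mul_assoc _ (iso α s), ← iso_mul_coeff, covariance, map_one, mul_one, map_mul]
      simp only [mul_assoc]
    rw [h]
    exact coeff_mul_mem_analyticSpan α _ hs

theorem exists_finsupp_of_mem_analyticSpan {z : StarCrossedProduct α} (hz : z ∈ analyticSpan α) :
    ∃ F : S →₀ A, z = F.sum fun t a => coeff α a * iso α t := by
  classical
  induction hz using Submodule.span_induction with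
  | mem z hz =>
    obtain ⟨a, t, rfl⟩ := hz
    exact ⟨Finsupp.single t a, by rw [Finsupp.sum_single_index]; simp⟩
  | zero => exact ⟨0, by simp⟩
  | add x y _ _ hx hy =>
    obtain ⟨F, rfl⟩ := hx
    obtain ⟨G, rfl⟩ := hy
    refine ⟨F + G, ?_⟩
    rw [Finsupp.sum_add_index']
    · simp
    · intros; rw [map_add, add_mul]
  | smul c x _ hx =>
    obtain ⟨F, rfl⟩ := hx
    refine ⟨c • F, ?_⟩
    rw [Finsupp.sum_smul_index' (by simp), Finsupp.smul_sum]
    exact Finsupp.sum_congr fun t _ => by rw [map_smul, smul_mul_assoc]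

/-- A *-homomorphism of the crossed product is injective if it is injective on the coefficients
and the spaces `A v_t` have independent images. -/
theorem injective_of_graded {B : Type*} [Ring B] [StarRing B] [Algebra ℂ B]
    (φ : StarCrossedProduct α →⋆ₐ[ℂ] B) (hφ : Function.Injective fun a => φ (coeff α a))
    (hgr : ∀ F : S →₀ A, (F.sum fun t a => φ (coeff α a) * φ (iso α t)) = 0 →
      ∀ t, φ (coeff α (F t)) * φ (iso α t) = 0) : Function.Injective φ := by
  rw [injective_iff_map_eq_zero]
  intro z hz
  obtain ⟨s, hs⟩ := exists_iso_mul_mem_analyticSpan α z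
  obtain ⟨F, hF⟩ := exists_finsupp_of_mem_analyticSpan α hs
  have h0 : (F.sum fun t a => φ (coeff α a) * φ (iso α t)) = 0 := by
    have h := congrArg φ hF
    rw [map_mul, hz, mul_zero, map_finsuppSum] at h
    simpa using h.symm
  have h1 : ∀ t, coeff α (F t) * iso α t = 0 := by
    intro t
    -- The projection α_t(1) = v_t v_t* need not be 1, so `F t` itself need not vanish. Only `F t *
    -- α t 1` is shown to be zero, which suffices because it has the same product with v_t as `F t`.
    have h2 : coeff α (F t * α t 1) * iso α t = coeff α (F t) * iso α t := by
      rw [map_mul, mul_assoc, ← iso_mul_coeff, map_one, mul_one]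
    have h3 : F t * α t 1 = 0 := by
      refine hφ ?_
      change φ (coeff α (F t * α t 1)) = φ (coeff α 0)
      rw [map_mul, covariance, map_one, mul_one, map_mul, map_mul, ← mul_assoc, hgr F h0 t,
        zero_mul, map_zero, map_zero]
    rw [← h2, h3, map_zero, zero_mul]
  have h4 : iso α s * z = 0 := by
    rw [hF]
    exact Finset.sum_eq_zero fun t _ => h1 t
  -- z is recovered as v_s*(v_s z).
  rw [← one_mul z, ← star_iso_mul_iso α s, mul_assoc, h4, mul_zero]

end CommMonoid

end StarCrossedProduct

/-! ### The semidirect product, the Hecke pair, and the index R(s). -/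

section FractionPair

variable {R : Type*} [CommRing R] (S : Submonoid R) (M : Type*) [AddCommGroup M] [Module R M]

/-- The component in `S⁻¹M`, written additively. -/
def FractionSemidirect.vec (γ : FractionSemidirect S M) : LocalizedModule S M := γ.left.toAdd

/-- The element `(n, 1)`. -/
noncomputable def vecEmb (n : LocalizedModule S M) : FractionSemidirect S M :=
  SemidirectProduct.inl (Multiplicative.ofAdd n)

/-- The element `(0, s)`. -/
noncomputable def denEmb (s : S) : FractionSemidirect S M :=
  SemidirectProduct.inr (toFractionGroup S s)

variable {S M}

open FractionSemidirect

theorem fractionSemidirect_ext {γ δ : FractionSemidirect S M} (h1 : vec S M γ = vec S M δ)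
    (h2 : γ.right = δ.right) : γ = δ := SemidirectProduct.ext h1 h2

theorem vec_mul (γ δ : FractionSemidirect S M) :
    vec S M (γ * δ) = vec S M γ +
      (((γ.right⁻¹ : fractionGroup S) : (Localization S)ˣ) : Localization S) • vec S M δ := rfl

theorem vec_vecEmb (n : LocalizedModule S M) : vec S M (vecEmb S M n) = n := rfl

theorem right_vecEmb (n : LocalizedModule S M) : (vecEmb S M n).right = 1 := rfl

theorem vec_denEmb (s : S) : vec S M (denEmb S M s) = 0 := rfl

theorem right_denEmb (s : S) : (denEmb S M s).right = toFractionGroup S s := rfl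

theorem coe_toFractionGroup (s : S) :
    ((toFractionGroup S s : (Localization S)ˣ) : Localization S) =
      algebraMap R (Localization S) s := rfl

theorem vec_mul_denEmb (s : S) (γ : FractionSemidirect S M) :
    vec S M (γ * denEmb S M s) = vec S M γ := by
  rw [vec_mul, vec_denEmb, smul_zero, add_zero]

theorem vec_vecEmb_mul (n : LocalizedModule S M) (γ : FractionSemidirect S M) :
    vec S M (vecEmb S M n * γ) = n + vec S M γ := by
  rw [vec_mul, vec_vecEmb, right_vecEmb, inv_one]
  simp

theorem right_vecEmb_mul (n : LocalizedModule S M) (γ : FractionSemidirect S M) :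
    (vecEmb S M n * γ).right = γ.right := one_mul _

theorem vec_inv (γ : FractionSemidirect S M) :
    vec S M γ⁻¹ = -(((γ.right : (Localization S)ˣ) : Localization S) • vec S M γ) := by
  have h := vec_mul γ⁻¹ γ
  rw [inv_mul_cancel, SemidirectProduct.inv_right, inv_inv] at h
  exact eq_neg_of_add_eq_zero_left h.symm

theorem vec_denEmb_inv_mul (s : S) (γ : FractionSemidirect S M) :
    vec S M ((denEmb S M s)⁻¹ * γ) = (s : R) • vec S M γ := by
  rw [vec_mul, vec_inv, vec_denEmb, smul_zero, neg_zero, zero_add, SemidirectProduct.inv_right,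
    inv_inv, right_denEmb, coe_toFractionGroup, algebraMap_smul]

theorem vecEmb_add (n m : LocalizedModule S M) :
    vecEmb S M (n + m) = vecEmb S M n * vecEmb S M m :=
  fractionSemidirect_ext (by simp only [vec_vecEmb_mul, vec_vecEmb]) (one_mul _).symm

theorem vecEmb_zero : vecEmb S M (0 : LocalizedModule S M) = 1 := rfl

theorem vecEmb_neg (n : LocalizedModule S M) : vecEmb S M (-n) = (vecEmb S M n)⁻¹ := by
  refine eq_inv_of_mul_eq_one_left ?_
  rw [← vecEmb_add, neg_add_cancel, vecEmb_zero]

/-- N is abelian, so only the component of γ in G acts. As ψ_g = g⁻¹, conjugation by γ⁻¹ multiplies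
by g itself; this is why (0,s) carries Γ₀ into Γ₀. -/
theorem vec_conj_vecEmb (γ : FractionSemidirect S M) (n : LocalizedModule S M) :
    γ⁻¹ * vecEmb S M n * γ =
      vecEmb S M (((γ.right : (Localization S)ˣ) : Localization S) • n) := by
  refine fractionSemidirect_ext ?_ ?_
  · rw [mul_assoc, vec_mul, vec_inv, vec_vecEmb_mul, vec_vecEmb, SemidirectProduct.inv_right,
      inv_inv, smul_add]
    abel
  · rw [mul_assoc, SemidirectProduct.mul_right, right_vecEmb_mul, SemidirectProduct.inv_right,
      inv_mul_cancel, right_vecEmb]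

theorem mem_moduleSubgroup {γ : FractionSemidirect S M} :
    γ ∈ moduleSubgroup S M ↔ γ.right = 1 ∧ vec S M γ ∈ moduleImage S M := by
  constructor
  · rintro ⟨n, hn, rfl⟩
    exact ⟨rfl, hn⟩
  · rintro ⟨h1, h2⟩
    exact ⟨γ.left, h2, SemidirectProduct.ext rfl h1.symm⟩

theorem vecEmb_mem_moduleSubgroup {n : LocalizedModule S M} :
    vecEmb S M n ∈ moduleSubgroup S M ↔ n ∈ moduleImage S M := by
  rw [mem_moduleSubgroup]; exact ⟨fun h => h.2, fun h => ⟨rfl, h⟩⟩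

theorem eq_vecEmb {γ : FractionSemidirect S M} (h : γ.right = 1) : γ = vecEmb S M (vec S M γ) :=
  fractionSemidirect_ext rfl h

theorem smul_injective (s : S) {n m : LocalizedModule S M} (h : (s : R) • n = (s : R) • m) :
    n = m :=
  IsLocalizedModule.smul_injective (LocalizedModule.mkLinearMap S M) s h

theorem smul_divBy (s : S) (n : LocalizedModule S M) :
    (s : R) • LocalizedModule.divBy s n = n := LocalizedModule.mul_by_divBy s n

theorem mem_fracImage {s : S} {n : LocalizedModule S M} :
    n ∈ fracImage S M s ↔ (s : R) • n ∈ moduleImage S M := by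
  constructor
  · rintro ⟨m, hm, rfl⟩
    rwa [smul_divBy]
  · intro h
    exact ⟨_, h, smul_injective s (smul_divBy s _)⟩

theorem toFractionGroup_injective (hS : S ≤ nonZeroDivisors R) :
    Function.Injective (toFractionGroup S) := by
  intro s t h
  have h1 := congrArg (fun g : fractionGroup S => ((g : (Localization S)ˣ) : Localization S)) h
  exact Subtype.ext (IsLocalization.injective (Localization S) hS h1)

theorem exists_fraction (g : fractionGroup S) :
    ∃ s t : S, g = (toFractionGroup S s)⁻¹ * toFractionGroup S t := by
  obtain ⟨s, t, h⟩ := g.2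
  refine ⟨s, t, eq_inv_mul_of_mul_eq (Subtype.ext (Units.ext ?_))⟩
  change algebraMap R (Localization S) s * ((g : (Localization S)ˣ) : Localization S) =
    algebraMap R (Localization S) t
  rw [h, Localization.mk_eq_mk', IsLocalization.mk'_spec']

open HeckeAlgebra

theorem vecEmb_mem_conjInto (n : LocalizedModule S M) :
    vecEmb S M n ∈ conjInto (moduleSubgroup S M) := by
  intro h hh
  have h1 := mem_moduleSubgroup.mp hh
  rwa [eq_vecEmb h1.1, ← vecEmb_neg, ← vecEmb_add, ← vecEmb_add, neg_add_cancel_comm,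
    ← eq_vecEmb h1.1]

/-- For γ over s⁻¹t, conjugation takes s l to (s⁻¹t)(s l) = t l, which lies in Γ₀. So the
denominator s alone ensures that sΓ₀ is conjugated into Γ₀. -/
theorem conj_mem_moduleSubgroup {γ h : FractionSemidirect S M} {s t : S} {l : LocalizedModule S M}
    (hγ : γ.right = (toFractionGroup S s)⁻¹ * toFractionGroup S t) (hl : l ∈ moduleImage S M)
    (hh : h = vecEmb S M ((s : R) • l)) : γ⁻¹ * h * γ ∈ moduleSubgroup S M := by
  rw [hh, vec_conj_vecEmb, vecEmb_mem_moduleSubgroup, ← algebraMap_smul (Localization S) (s : R),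
    smul_smul, hγ]
  have h1 : ((((toFractionGroup S s)⁻¹ * toFractionGroup S t : fractionGroup S) :
      (Localization S)ˣ) : Localization S) * algebraMap R (Localization S) s =
        algebraMap R (Localization S) t := by
    rw [← coe_toFractionGroup, ← coe_toFractionGroup, ← Units.val_mul, ← Subgroup.coe_mul,
      mul_comm (toFractionGroup S s)⁻¹, inv_mul_cancel_right]
  rw [h1, algebraMap_smul]
  exact Submodule.smul_mem _ _ hl

theorem denEmb_mem_conjInto (s : S) : denEmb S M s ∈ conjInto (moduleSubgroup S M) := by
  intro h hh
  obtain ⟨h1, h2⟩ := mem_moduleSubgroup.mp hh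
  refine conj_mem_moduleSubgroup (s := 1) (t := s) (l := vec S M h) ?_ h2 ?_
  · rw [right_denEmb, show toFractionGroup S 1 = 1 from Subtype.ext (Units.ext (map_one _)),
      inv_one, one_mul]
  · rw [OneMemClass.coe_one, one_smul, ← eq_vecEmb h1]

theorem inv_quotient_out_sub_mem (s : S) (x : fracImage S M s) :
    ((Submodule.Quotient.mk x : InvQuotient S M s).out : LocalizedModule S M) - x ∈
      moduleImage S M :=
  (Submodule.Quotient.eq ((moduleImage S M).submoduleOf (fracImage S M s))).mp
    (Quotient.out_eq (Submodule.Quotient.mk x : InvQuotient S M s))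

/-- For γ over s⁻¹t, the left coset lγΓ₀ depends on l ∈ Γ₀ only modulo sΓ₀, and division by s
identifies Γ₀/sΓ₀ with the finite group s⁻¹Γ₀/Γ₀. -/
theorem isHeckePair_moduleSubgroup (hfin : ∀ s : S, Finite (InvQuotient S M s)) :
    IsHeckePair (moduleSubgroup S M) := by
  constructor
  intro γ
  obtain ⟨s, t, hst⟩ := exists_fraction γ.right
  have := hfin s
  refine (Set.finite_range fun q : InvQuotient S M s =>
    ((vecEmb S M ((s : R) • (q.out : LocalizedModule S M)) * γ : FractionSemidirect S M) :
      FractionSemidirect S M ⧸ moduleSubgroup S M)).subset ?_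
  rintro _ ⟨y, hy, rfl⟩
  obtain ⟨a, ha, b, hb, rfl⟩ := DoubleCoset.mem_doubleCoset.mp hy
  obtain ⟨l, hl, rfl⟩ : ∃ l ∈ moduleImage S M, a = vecEmb S M l :=
    ⟨_, (mem_moduleSubgroup.mp ha).2, eq_vecEmb (mem_moduleSubgroup.mp ha).1⟩
  have hx : LocalizedModule.divBy s l ∈ fracImage S M s :=
    mem_fracImage.mpr (by rwa [smul_divBy])
  refine ⟨Submodule.Quotient.mk ⟨_, hx⟩, QuotientGroup.eq.mpr ?_⟩
  have h := inv_quotient_out_sub_mem s ⟨_, hx⟩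
  rw [mul_inv_rev, ← mul_assoc]
  refine mul_mem ?_ hb
  rw [← mul_assoc, mul_assoc γ⁻¹]
  refine conj_mem_moduleSubgroup hst (neg_mem h) ?_
  rw [← vecEmb_neg, ← vecEmb_add, neg_sub, smul_sub, smul_divBy, neg_add_eq_sub]

theorem vecEmb_mul_denEmb_mem {s : S} {n : LocalizedModule S M} :
    (denEmb S M s)⁻¹ * (vecEmb S M n * denEmb S M s) ∈ moduleSubgroup S M ↔
      n ∈ fracImage S M s := by
  rw [mem_fracImage, ← mul_assoc, vec_conj_vecEmb, vecEmb_mem_moduleSubgroup, right_denEmb,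
    coe_toFractionGroup, algebraMap_smul]

theorem vecEmb_mul_mul_inv_mem {n m : LocalizedModule S M} {γ : FractionSemidirect S M} :
    vecEmb S M n * γ * (vecEmb S M m * γ)⁻¹ ∈ moduleSubgroup S M ↔ n - m ∈ moduleImage S M := by
  rw [mul_inv_rev, mul_assoc, mul_inv_cancel_left, ← vecEmb_neg, ← vecEmb_add,
    vecEmb_mem_moduleSubgroup, sub_eq_add_neg]

/-- The double coset of (0,s) consists of the products (n,1)(0,s) with n ∈ s⁻¹Γ₀, and two of them
are in the same right coset exactly if their n agree modulo Γ₀. -/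
theorem rightIndex_denEmb (s : S) :
    rightIndex (moduleSubgroup S M) (denEmb S M s) = Nat.card (InvQuotient S M s) := by
  have hmem : ∀ q : InvQuotient S M s, (Quotient.mk (QuotientGroup.rightRel (moduleSubgroup S M))
      (vecEmb S M (q.out : LocalizedModule S M) * denEmb S M s)).out ∈ DoubleCoset.doubleCoset
        (denEmb S M s) (moduleSubgroup S M : Set (FractionSemidirect S M)) (moduleSubgroup S M) :=
    fun q => DoubleCoset.mem_doubleCoset.mpr ⟨_,
      inv_mem (rightCosets_out_mul_inv_mem
      (vecEmb S M (q.out : LocalizedModule S M) * denEmb S M s)), _,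
      vecEmb_mul_denEmb_mem.mpr q.out.2, by group⟩
  refine (Nat.card_eq_of_bijective (fun q : InvQuotient S M s => ⟨_, hmem q⟩) ⟨?_, ?_⟩).symm
  · intro q q' h
    have h1 := QuotientGroup.rightRel_apply.mp (Quotient.exact (congrArg Subtype.val h))
    rw [vecEmb_mul_mul_inv_mem] at h1
    rw [← Quotient.out_eq q, ← Quotient.out_eq q']
    exact ((Submodule.Quotient.eq ((moduleImage S M).submoduleOf (fracImage S M s))).mpr h1).symm
  · rintro ⟨q, hq⟩
    rw [mem_doubleCoset_iff (denEmb_mem_conjInto s)] at hq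
    have h1 : q.out = vecEmb S M (vec S M q.out) * denEmb S M s := by
      refine fractionSemidirect_ext (by rw [vec_mul_denEmb, vec_vecEmb]) ?_
      rw [right_vecEmb_mul]
      exact (inv_mul_eq_one.mp (mem_moduleSubgroup.mp hq).1).symm
    rw [h1, vecEmb_mul_denEmb_mem] at hq
    refine ⟨Submodule.Quotient.mk ⟨_, hq⟩, Subtype.ext ?_⟩
    refine Eq.trans (Quotient.sound (QuotientGroup.rightRel_apply.mpr ?_))
      ((congrArg (Quotient.mk _) h1).symm.trans (Quotient.out_eq q))
    rw [vecEmb_mul_mul_inv_mem, ← neg_sub]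
    exact neg_mem (inv_quotient_out_sub_mem s ⟨_, hq⟩)

end FractionPair

/-! ### The group algebra of N/Γ₀ inside the Hecke algebra. -/

section CoefficientEmbedding

open HeckeAlgebra FractionSemidirect

variable {R : Type*} [CommRing R] {S : Submonoid R} {M : Type*} [AddCommGroup M] [Module R M]

theorem fractionClass_eq_iff {n m : LocalizedModule S M} :
    fractionClass S M n = fractionClass S M m ↔ n - m ∈ moduleImage S M :=
  Submodule.Quotient.eq _

theorem fractionClass_surjective : Function.Surjective (fractionClass S M) :=
  Submodule.Quotient.mk_surjective _

/-- The group *-algebra is spanned by the canonical unitaries. -/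
theorem GroupStarAlgebra.induction {Q : Type*} [AddCommGroup Q] {P : GroupStarAlgebra Q → Prop}
    (a : GroupStarAlgebra Q) (zero : P 0) (add : ∀ a b, P a → P b → P (a + b))
    (smul : ∀ (c : ℂ) x, P (c • GroupStarAlgebra.e x)) : P a := by
  induction a using MonoidAlgebra.induction_linear with
  | zero => exact zero
  | add f g hf hg => exact add _ _ hf hg
  | single w c =>
    have h := smul c (Multiplicative.toAdd (α := Q) w)
    rwa [GroupStarAlgebra.e, MonoidAlgebra.smul_single, smul_eq_mul, mul_one] at h

theorem GroupStarAlgebra.star_e {Q : Type*} [AddCommGroup Q] (x : Q) :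
    star (GroupStarAlgebra.e x) = GroupStarAlgebra.e (-x) := by
  change monoidAlgebraStar _ _ = _
  rw [GroupStarAlgebra.e, monoidAlgebraStar_single, star_one]
  rfl

theorem GroupStarAlgebra.coeff_e {Q : Type*} [AddCommGroup Q] [DecidableEq Q] (x y : Q) :
    (GroupStarAlgebra.e x).coeff (StarGroup.of y) = if x = y then 1 else 0 := by
  classical
  rw [GroupStarAlgebra.e, MonoidAlgebra.coeff_single, Finsupp.single_apply]
  congr 1

variable [IsHeckePair (moduleSubgroup S M)]

-- N is abelian, so the double coset of (n,1) is the single class n + Γ₀ placed over 1.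
open Classical in
theorem char_vecEmb_apply (n : LocalizedModule S M) (γ : FractionSemidirect S M) :
    (char (moduleSubgroup S M) (vecEmb S M n)).1 γ =
      if γ.right = 1 ∧ fractionClass S M n = fractionClass S M (vec S M γ) then 1 else 0 := by
  rw [char_apply (vecEmb_mem_conjInto n), ← vecEmb_neg, mem_moduleSubgroup, right_vecEmb_mul,
    vec_vecEmb_mul, fractionClass_eq_iff, ← neg_mem_iff, neg_add, neg_neg, ← sub_eq_add_neg]
  congr

theorem char_vecEmb_congr {n m : LocalizedModule S M}
    (h : fractionClass S M n = fractionClass S M m) :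
    char (moduleSubgroup S M) (vecEmb S M n) = char (moduleSubgroup S M) (vecEmb S M m) := by
  ext γ
  rw [char_vecEmb_apply, char_vecEmb_apply, h]

theorem star_char_vecEmb (n : LocalizedModule S M) :
    star (char (moduleSubgroup S M) (vecEmb S M n)) =
      char (moduleSubgroup S M) (vecEmb S M (-n)) := by
  classical
  ext γ
  rw [star_apply, char_vecEmb_apply, char_vecEmb_apply, SemidirectProduct.inv_right]
  by_cases h : γ.right = 1
  · have h2 : fractionClass S M n = fractionClass S M (vec S M γ⁻¹) ↔
        fractionClass S M (-n) = fractionClass S M (vec S M γ) := by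
      rw [vec_inv, h, fractionClass_eq_iff, fractionClass_eq_iff, ← neg_mem_iff]
      simp [sub_eq_add_neg, add_comm]
    simp [h, h2]
  · simp [h]

variable (S M) in
/-- The representation of `S⁻¹M / M` in the Hecke algebra. -/
noncomputable def classChar : StarGroup (FractionQuotient S M) →* HeckeAlgebra (moduleSubgroup S M)
    where
  toFun x := char _ (vecEmb S M (Multiplicative.toAdd (α := FractionQuotient S M) x).out)
  map_one' := by
    rw [← char_one, ← vecEmb_zero (S := S) (M := M)]
    exact char_vecEmb_congr (Quotient.out_eq _)
  map_mul' x y := by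
    rw [char_mul_char (vecEmb_mem_conjInto _) (vecEmb_mem_conjInto _), ← vecEmb_add]
    refine char_vecEmb_congr ((Quotient.out_eq _).trans ?_)
    exact (congrArg₂ (fun a b : FractionQuotient S M => a + b)
      (Quotient.out_eq (Multiplicative.toAdd (α := FractionQuotient S M) x))
      (Quotient.out_eq (Multiplicative.toAdd (α := FractionQuotient S M) y))).symm

variable (S M) in
/-- The homomorphism `ℂ(S⁻¹M / M) → H(S⁻¹M ⋊ S⁻¹S, M)` as a homomorphism of algebras. -/
noncomputable def coeffAlgHom :
    GroupStarAlgebra (FractionQuotient S M) →ₐ[ℂ] HeckeAlgebra (moduleSubgroup S M) :=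
  MonoidAlgebra.lift ℂ _ _ (classChar S M)

theorem coeffAlgHom_e (n : LocalizedModule S M) :
    coeffAlgHom S M (GroupStarAlgebra.e (fractionClass S M n)) = char _ (vecEmb S M n) := by
  rw [coeffAlgHom, GroupStarAlgebra.e, MonoidAlgebra.lift_single, one_smul]
  exact char_vecEmb_congr (Quotient.out_eq _)

variable (S M) in
/-- The *-homomorphism `ℂ(S⁻¹M / M) → H(S⁻¹M ⋊ S⁻¹S, M)` that maps `e(n + M)` to `[n]`. -/
noncomputable def coeffHom :
    GroupStarAlgebra (FractionQuotient S M) →⋆ₐ[ℂ] HeckeAlgebra (moduleSubgroup S M) where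
  __ := coeffAlgHom S M
  map_star' a := by
    change coeffAlgHom S M _ = star (coeffAlgHom S M _)
    induction a using GroupStarAlgebra.induction with
    | zero => simp
    | add a b ha hb => rw [star_add, map_add, map_add, star_add, ha, hb]
    | smul c x =>
      obtain ⟨n, rfl⟩ := fractionClass_surjective x
      rw [star_smul, map_smul, map_smul, star_smul, GroupStarAlgebra.star_e, coeffAlgHom_e,
        star_char_vecEmb, ← coeffAlgHom_e]
      rfl

theorem coeffHom_e (n : LocalizedModule S M) :
    coeffHom S M (GroupStarAlgebra.e (fractionClass S M n)) = char _ (vecEmb S M n) :=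
  coeffAlgHom_e n

-- The embedding turns coefficients into values, so identities in ℂ(N/Γ₀) can be checked by
-- evaluating functions at the points (m,1).
open Classical in
theorem coeffHom_apply (a : GroupStarAlgebra (FractionQuotient S M)) (γ : FractionSemidirect S M) :
    (coeffHom S M a).1 γ =
      if γ.right = 1 then a.coeff (StarGroup.of (fractionClass S M (vec S M γ))) else 0 := by
  induction a using GroupStarAlgebra.induction with
  | zero => rw [map_zero, HeckeAlgebra.zero_apply]; simp
  | add a b ha hb =>
    rw [map_add, HeckeAlgebra.add_apply, ha, hb]
    split_ifs <;> simp
  | smul c x =>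
    obtain ⟨n, rfl⟩ := fractionClass_surjective x
    rw [map_smul, HeckeAlgebra.smul_apply, coeffHom_e, char_vecEmb_apply, MonoidAlgebra.coeff_smul,
      Finsupp.smul_apply, GroupStarAlgebra.coeff_e, smul_eq_mul, ite_and]
    split_ifs <;> simp

theorem coeffHom_injective : Function.Injective (coeffHom S M) := by
  rw [injective_iff_map_eq_zero]
  intro a ha
  ext x
  obtain ⟨n, hn⟩ := fractionClass_surjective (Multiplicative.toAdd (α := FractionQuotient S M) x)
  have h := coeffHom_apply a (vecEmb S M n)
  rw [ha, if_pos (right_vecEmb n), vec_vecEmb, hn] at h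
  exact h.symm

/-- An invariant function that lives over 1 is a function on N/Γ₀. Each double coset over 1 is one
class, so support in finitely many double cosets becomes finite support on N/Γ₀. -/
theorem exists_coeffHom_eq {f : HeckeAlgebra (moduleSubgroup S M)}
    (hf : ∀ γ : FractionSemidirect S M, γ.right ≠ 1 → f.1 γ = 0) : ∃ a, coeffHom S M a = f := by
  classical
  have hcl : ∀ n m : LocalizedModule S M, fractionClass S M n = fractionClass S M m →
      f.1 (vecEmb S M n) = f.1 (vecEmb S M m) := by
    intro n m h
    rw [← sub_add_cancel n m, vecEmb_add]
    exact f.2.1 _ (vecEmb_mem_moduleSubgroup.mpr (fractionClass_eq_iff.mp h)) _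
  obtain ⟨T, hT, hfT⟩ := f.2.2.2
  have hfin : (Function.support fun x : StarGroup (FractionQuotient S M) =>
      f.1 (vecEmb S M (Multiplicative.toAdd (α := FractionQuotient S M) x).out)).Finite := by
    refine (hT.image fun t => StarGroup.of (fractionClass S M (vec S M t))).subset fun x hx => ?_
    have h1 := hfT hx
    simp only [Set.mem_iUnion] at h1
    obtain ⟨t, ht, h2⟩ := h1
    obtain ⟨a, ha, b, hb, hab⟩ := DoubleCoset.mem_doubleCoset.mp h2
    obtain ⟨ha1, ha2⟩ := mem_moduleSubgroup.mp ha
    obtain ⟨hb1, hb2⟩ := mem_moduleSubgroup.mp hb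
    -- Elements of Γ₀ lie over 1, hence so does the representative t; then x and t differ by an
    -- element of Γ₀.
    have h3 := congrArg SemidirectProduct.right hab
    rw [SemidirectProduct.mul_right, SemidirectProduct.mul_right, ha1, hb1, right_vecEmb, one_mul,
      mul_one] at h3
    have h4 := congrArg (vec S M) hab
    rw [eq_vecEmb ha1, eq_vecEmb h3.symm, eq_vecEmb hb1, ← vecEmb_add, ← vecEmb_add, vec_vecEmb,
      vec_vecEmb] at h4
    refine ⟨t, ht, Eq.trans ((fractionClass_eq_iff (m :=
      (Multiplicative.toAdd (α := FractionQuotient S M) x).out)).mpr ?_) (Quotient.out_eq _)⟩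
    rw [h4, ← neg_mem_iff]
    convert add_mem ha2 hb2 using 1
    abel
  refine ⟨MonoidAlgebra.ofCoeff (Finsupp.ofSupportFinite _ hfin), ?_⟩
  ext γ
  rw [coeffHom_apply]
  split_ifs with h
  · conv_rhs => rw [eq_vecEmb h]
    exact hcl _ _ (Quotient.out_eq _)
  · exact (hf γ h).symm

end CoefficientEmbedding

/-! ### The action of S and the isomorphism onto the Hecke algebra. -/

section HeckeIsomorphism

open HeckeAlgebra FractionSemidirect

variable {R : Type*} [CommRing R] {S : Submonoid R} {M : Type*} [AddCommGroup M] [Module R M]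

theorem toFractionGroup_one : toFractionGroup S 1 = 1 := Subtype.ext (Units.ext (map_one _))

theorem toFractionGroup_mul (s t : S) :
    toFractionGroup S (s * t) = toFractionGroup S s * toFractionGroup S t :=
  Subtype.ext (Units.ext (map_mul _ _ _))

variable (S M) in
/-- The homomorphism `s ↦ (0, s)`. -/
noncomputable def denHom : S →* conjInto (moduleSubgroup S M) where
  toFun s := ⟨denEmb S M s, denEmb_mem_conjInto s⟩
  map_one' := Subtype.ext (by
    change denEmb S M 1 = 1
    rw [denEmb, toFractionGroup_one, map_one])
  map_mul' s t := Subtype.ext (by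
    change denEmb S M (s * t) = denEmb S M s * denEmb S M t
    rw [denEmb, toFractionGroup_mul, map_mul]; rfl)

theorem right_conj (s t : S) (γ : FractionSemidirect S M) :
    ((denEmb S M s)⁻¹ * γ * denEmb S M t).right =
      (toFractionGroup S s)⁻¹ * γ.right * toFractionGroup S t := rfl

variable [IsHeckePair (moduleSubgroup S M)]

variable (S M) in
/-- The representation of `S` by the isometries `R(s)^{-1/2} [s]` of the Hecke algebra. -/
noncomputable def denIsometry : S →* HeckeAlgebra (moduleSubgroup S M) :=
  (charIsometry (moduleSubgroup S M)).comp (denHom S M)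

theorem denIsometry_apply (s : S) : denIsometry S M s =
    (((√(Nat.card (InvQuotient S M s)))⁻¹ : ℝ) : ℂ) • char _ (denEmb S M s) := by
  rw [← rightIndex_denEmb]
  rfl

theorem star_denIsometry_mul (s : S) : star (denIsometry S M s) * denIsometry S M s = 1 :=
  star_charIsometry_mul _

theorem denIsometry_conj_apply (s t : S) (f : HeckeAlgebra (moduleSubgroup S M))
    (γ : FractionSemidirect S M) : (denIsometry S M s * f * star (denIsometry S M t)).1 γ =
      (((√(Nat.card (InvQuotient S M s)))⁻¹ * (√(Nat.card (InvQuotient S M t)))⁻¹ : ℝ) : ℂ) *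
        f.1 ((denEmb S M s)⁻¹ * γ * denEmb S M t) := by
  rw [← rightIndex_denEmb, ← rightIndex_denEmb]
  exact charIsometry_conj_apply _ _ f γ

theorem exists_coeffHom_eq_conj (s : S) (a : GroupStarAlgebra (FractionQuotient S M)) :
    ∃ b, coeffHom S M b = denIsometry S M s * coeffHom S M a * star (denIsometry S M s) := by
  classical
  refine exists_coeffHom_eq fun γ hγ => ?_
  rw [denIsometry_conj_apply, coeffHom_apply, if_neg, mul_zero]
  -- Conjugation by s does not change the component in the commutative group G.
  rw [right_conj, mul_comm _ γ.right, inv_mul_cancel_right]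
  exact hγ

/-- The endomorphism `α_s` of `ℂ(S⁻¹M / M)`, as a function. -/
noncomputable def coeffConj (s : S) (a : GroupStarAlgebra (FractionQuotient S M)) :
    GroupStarAlgebra (FractionQuotient S M) := (exists_coeffHom_eq_conj s a).choose

theorem coeffHom_coeffConj (s : S) (a : GroupStarAlgebra (FractionQuotient S M)) :
    coeffHom S M (coeffConj s a) =
      denIsometry S M s * coeffHom S M a * star (denIsometry S M s) :=
  (exists_coeffHom_eq_conj s a).choose_spec

/-- Injectivity of `coeffHom` makes the chosen preimage unique, so each law of the action becomes an
identity between conjugates in the Hecke algebra. -/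
theorem coeffConj_eq_iff (s : S) (a b : GroupStarAlgebra (FractionQuotient S M)) :
    coeffConj s a = b ↔
      denIsometry S M s * coeffHom S M a * star (denIsometry S M s) = coeffHom S M b := by
  rw [← coeffHom_coeffConj, coeffHom_injective.eq_iff]

variable (S M) in
/-- The action `α` of `S` on `ℂ(S⁻¹M / M)`. -/
noncomputable def coeffAction : S →* (GroupStarAlgebra (FractionQuotient S M) →⋆ₙₐ[ℂ]
    GroupStarAlgebra (FractionQuotient S M)) where
  toFun s :=
    { toFun := coeffConj s
      map_smul' c a := by
        rw [coeffConj_eq_iff, MonoidHom.id_apply, map_smul, map_smul, coeffHom_coeffConj,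
          mul_smul_comm, smul_mul_assoc]
      map_zero' := by
        rw [coeffConj_eq_iff, map_zero, mul_zero, zero_mul]
      map_add' a b := by
        rw [coeffConj_eq_iff, map_add, map_add, coeffHom_coeffConj, coeffHom_coeffConj, mul_add,
          add_mul]
      map_mul' a b := by
        rw [coeffConj_eq_iff, map_mul, map_mul, coeffHom_coeffConj, coeffHom_coeffConj]
        simp only [mul_assoc]
        -- The inner factor V_s*V_s = 1 makes conjugation multiplicative. It is not unital in
        -- general, since 1 is sent to V_sV_s*.
        rw [← mul_assoc (star (denIsometry S M s)) (denIsometry S M s), star_denIsometry_mul,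
          one_mul]
      map_star' a := by
        rw [coeffConj_eq_iff, map_star, map_star, coeffHom_coeffConj, star_mul, star_mul,
          star_star, mul_assoc] }
  map_one' := by
    ext1 a
    change coeffConj 1 a = a
    rw [coeffConj_eq_iff, map_one, star_one, one_mul, mul_one]
  map_mul' s t := by
    ext1 a
    change coeffConj (s * t) a = coeffConj s (coeffConj t a)
    rw [coeffConj_eq_iff, coeffHom_coeffConj, coeffHom_coeffConj, map_mul, star_mul]
    simp only [mul_assoc]

theorem coeffHom_coeffAction (s : S) (a : GroupStarAlgebra (FractionQuotient S M)) :
    coeffHom S M (coeffAction S M s a) =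
      denIsometry S M s * coeffHom S M a * star (denIsometry S M s) :=
  coeffHom_coeffConj s a

/-- As c ≠ 0, the set `T` is contained in the finite support of `a`. Finiteness is recorded because
`finsum` takes the value 0 on a family with infinite support, and because the sum is later moved
through a homomorphism. -/
theorem GroupStarAlgebra.eq_smul_finsum {Q : Type*} [AddCommGroup Q] {a : GroupStarAlgebra Q}
    {c : ℂ} (hc : c ≠ 0) {T : Set Q} (h1 : ∀ x ∈ T, a.coeff (StarGroup.of x) = c)
    (h2 : ∀ x ∉ T, a.coeff (StarGroup.of x) = 0) :
    T.Finite ∧ a = c • ∑ᶠ x ∈ T, GroupStarAlgebra.e x := by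
  classical
  have hT : T.Finite := by
    refine (a.coeff.hasFiniteSupport).subset fun x hx => ?_
    exact (h1 x hx).trans_ne hc
  refine ⟨hT, ?_⟩
  rw [finsum_mem_eq_finite_toFinset_sum _ hT]
  have key : ∀ x : Q, a.coeff (StarGroup.of x) =
      (c • ∑ y ∈ hT.toFinset, GroupStarAlgebra.e y).coeff (StarGroup.of x) := by
    intro x
    rw [MonoidAlgebra.coeff_smul, MonoidAlgebra.coeff_sum, Finsupp.smul_apply,
      Finsupp.finsetSum_apply, Finset.sum_congr rfl fun y _ => GroupStarAlgebra.coeff_e y x,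
      Finset.sum_ite_eq']
    by_cases hx : x ∈ T
    · simpa [hx] using h1 x hx
    · simpa [hx] using h2 x hx
  ext w
  exact key w

theorem card_invQuotient_pos (s : S) : 0 < Nat.card (InvQuotient S M s) := by
  rw [← rightIndex_denEmb]
  exact rightIndex_pos _

/-- The coefficient at m + Γ₀ is the value of V_s[n]V_s* at (m,1), which is R(s)⁻¹ times the value
of [n] at (sm,1). It is nonzero exactly if sm and n have the same class. -/
theorem coeffAction_e (s : S) (x : FractionQuotient S M) :
    {y : FractionQuotient S M | (s : R) • y = x}.Finite ∧
    coeffAction S M s (GroupStarAlgebra.e x) = (Nat.card (InvQuotient S M s) : ℂ)⁻¹ •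
      ∑ᶠ y ∈ {y : FractionQuotient S M | (s : R) • y = x}, GroupStarAlgebra.e y := by
  classical
  obtain ⟨n, rfl⟩ := fractionClass_surjective x
  have key : ∀ y : FractionQuotient S M,
      (coeffAction S M s (GroupStarAlgebra.e (fractionClass S M n))).coeff (StarGroup.of y) =
        if (s : R) • y = fractionClass S M n then (Nat.card (InvQuotient S M s) : ℂ)⁻¹ else 0 := by
    intro y
    obtain ⟨m, rfl⟩ := fractionClass_surjective y
    have h := coeffHom_apply (coeffAction S M s (GroupStarAlgebra.e (fractionClass S M n)))
      (vecEmb S M m)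
    rw [if_pos (right_vecEmb m), vec_vecEmb, coeffHom_coeffAction, denIsometry_conj_apply,
      coeffHom_e, char_vecEmb_apply, right_conj, vec_mul_denEmb, vec_denEmb_inv_mul, vec_vecEmb,
      right_vecEmb] at h
    -- Each of the two isometries contributes a factor R(s)^{-1/2}.
    rw [← h, ← mul_inv, Real.mul_self_sqrt (Nat.cast_nonneg _)]
    have h2 : (s : R) • fractionClass S M m = fractionClass S M ((s : R) • m) := rfl
    simp [h2, eq_comm]
  have hc : (Nat.card (InvQuotient S M s) : ℂ)⁻¹ ≠ 0 :=
    inv_ne_zero (by exact_mod_cast (card_invQuotient_pos s).ne')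
  exact GroupStarAlgebra.eq_smul_finsum hc (fun y hy => (key y).trans (if_pos hy))
    (fun y hy => (key y).trans (if_neg hy))

/-- The part of a function in the Hecke algebra that lives over `g`. -/
noncomputable def component (g : fractionGroup S) (f : HeckeAlgebra (moduleSubgroup S M)) :
    HeckeAlgebra (moduleSubgroup S M) :=
  ⟨Set.indicator {γ | γ.right = g} f.1, by
    classical
    have hl : ∀ h ∈ moduleSubgroup S M, ∀ γ, (h * γ).right = γ.right := fun h hh γ => by
      rw [SemidirectProduct.mul_right, (mem_moduleSubgroup.mp hh).1, one_mul]
    have hr : ∀ h ∈ moduleSubgroup S M, ∀ γ, (γ * h).right = γ.right := fun h hh γ => by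
      rw [SemidirectProduct.mul_right, (mem_moduleSubgroup.mp hh).1, mul_one]
    refine ⟨fun h hh γ => ?_, fun h hh γ => ?_, ?_⟩
    · simp only [Set.indicator_apply, Set.mem_ofPred_eq, hl h hh, f.2.1 h hh]
    · simp only [Set.indicator_apply, Set.mem_ofPred_eq, hr h hh, f.2.2.1 h hh]
    · obtain ⟨T, hT, hfT⟩ := f.2.2.2
      exact ⟨T, hT, (Set.support_indicator.trans_subset Set.inter_subset_right).trans hfT⟩⟩

open Classical in
theorem component_apply (g : fractionGroup S) (f : HeckeAlgebra (moduleSubgroup S M))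
    (γ : FractionSemidirect S M) : (component g f).1 γ = if γ.right = g then f.1 γ else 0 :=
  Set.indicator_apply _ _ _

theorem exists_sum_component (f : HeckeAlgebra (moduleSubgroup S M)) :
    ∃ T : Finset (fractionGroup S), f = ∑ g ∈ T, component g f := by
  classical
  obtain ⟨T, hT, hfT⟩ := f.2.2.2
  -- All elements of a double coset have the same component in G, so only the components of the
  -- finitely many representatives occur.
  refine ⟨hT.toFinset.image SemidirectProduct.right, ?_⟩
  ext γ
  rw [HeckeAlgebra.sum_apply, Finset.sum_congr rfl fun g _ => component_apply g f γ,
    Finset.sum_ite_eq]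
  split_ifs with h
  · rfl
  · by_contra h0
    have h1 := hfT h0
    simp only [Set.mem_iUnion] at h1
    obtain ⟨t, ht, h2⟩ := h1
    refine h (Finset.mem_image.mpr ⟨t, hT.mem_toFinset.mpr ht, ?_⟩)
    obtain ⟨a, ha, b, hb, rfl⟩ := DoubleCoset.mem_doubleCoset.mp h2
    rw [SemidirectProduct.mul_right, SemidirectProduct.mul_right, (mem_moduleSubgroup.mp ha).1,
      (mem_moduleSubgroup.mp hb).1, one_mul, mul_one]

/-- The functions that live over one element are `v_s* a v_t`. -/
theorem exists_eq_star_mul_coeffHom_mul {f : HeckeAlgebra (moduleSubgroup S M)}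
    {g : fractionGroup S} (hf : ∀ γ : FractionSemidirect S M, γ.right ≠ g → f.1 γ = 0) :
    ∃ s t a, f = star (denIsometry S M s) * coeffHom S M a * denIsometry S M t := by
  obtain ⟨s, t, rfl⟩ := exists_fraction g
  -- The value of V_s f V_t* at γ involves f at s⁻¹γt, which lies over s⁻¹t only if γ lies over 1.
  obtain ⟨a, ha⟩ : ∃ a, coeffHom S M a = denIsometry S M s * f * star (denIsometry S M t) := by
    refine exists_coeffHom_eq fun γ hγ => ?_
    rw [denIsometry_conj_apply, hf, mul_zero]
    rw [right_conj]
    intro h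
    refine hγ ?_
    rwa [mul_assoc, mul_right_inj, mul_eq_right] at h
  refine ⟨s, t, a, ?_⟩
  rw [ha]
  simp only [mul_assoc]
  rw [star_denIsometry_mul, mul_one, ← mul_assoc, star_denIsometry_mul, one_mul]

/-- This is the grading behind injectivity: a V_t lives over t. In each nonzero term of the
convolution q lies over t, and γq⁻¹ lies over 1. -/
theorem coeffHom_mul_denIsometry_apply (t : S) (a : GroupStarAlgebra (FractionQuotient S M))
    {γ : FractionSemidirect S M} (hγ : γ.right ≠ toFractionGroup S t) :
    (coeffHom S M a * denIsometry S M t).1 γ = 0 := by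
  classical
  rw [mul_apply]
  refine (finsum_congr fun q => ?_).trans finsum_zero
  rw [coeffHom_apply, denIsometry_apply, HeckeAlgebra.smul_apply,
    char_apply (denEmb_mem_conjInto t)]
  by_cases h : (denEmb S M t)⁻¹ * q.out ∈ moduleSubgroup S M
  · have h1 : toFractionGroup S t = q.out.right :=
      inv_mul_eq_one.mp (mem_moduleSubgroup.mp h).1
    rw [if_neg, zero_mul]
    rw [SemidirectProduct.mul_right, SemidirectProduct.inv_right, ← h1, mul_inv_eq_one]
    exact hγ
  · rw [if_neg h, mul_zero, mul_zero]

variable (S M) in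
/-- The *-homomorphism of the crossed product to the Hecke algebra. -/
noncomputable def toHecke :
    StarCrossedProduct (coeffAction S M) →⋆ₐ[ℂ] HeckeAlgebra (moduleSubgroup S M) :=
  StarCrossedProduct.lift _ (coeffHom S M) (denIsometry S M) star_denIsometry_mul
    coeffHom_coeffAction

theorem toHecke_coeff (a : GroupStarAlgebra (FractionQuotient S M)) :
    toHecke S M (StarCrossedProduct.coeff _ a) = coeffHom S M a :=
  StarCrossedProduct.lift_coeff _ _ a

theorem toHecke_iso (s : S) : toHecke S M (StarCrossedProduct.iso _ s) = denIsometry S M s :=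
  StarCrossedProduct.lift_iso _ _ s

theorem toHecke_surjective : Function.Surjective (toHecke S M) := by
  intro f
  obtain ⟨T, hT⟩ := exists_sum_component f
  have h : ∀ g, ∃ z, toHecke S M z = component g f := by
    classical
    intro g
    obtain ⟨s, t, a, h⟩ := exists_eq_star_mul_coeffHom_mul (f := component g f) (g := g)
      fun γ hγ => by rw [component_apply, if_neg hγ]
    refine ⟨star (StarCrossedProduct.iso _ s) * StarCrossedProduct.coeff _ a *
      StarCrossedProduct.iso _ t, ?_⟩
    rw [map_mul, map_mul, map_star, toHecke_coeff, toHecke_iso, toHecke_iso, h]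
  choose z hz using h
  refine ⟨∑ g ∈ T, z g, ?_⟩
  rw [map_sum]
  refine Eq.trans ?_ hT.symm
  exact Finset.sum_congr rfl fun g _ => hz g

/-- The absence of zero-divisors enters only here, through S → G being injective: the summand for t
is isolated by evaluating at points over t, where those for u ≠ t vanish. -/
theorem toHecke_injective (hS : S ≤ nonZeroDivisors R) : Function.Injective (toHecke S M) := by
  classical
  refine StarCrossedProduct.injective_of_graded _ _ ?_ ?_
  · intro a b h
    simp only [toHecke_coeff] at h
    exact coeffHom_injective h
  · intro F hF t
    simp only [toHecke_coeff, toHecke_iso] at hF ⊢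
    ext γ
    by_cases hγ : γ.right = toFractionGroup S t
    · have h := congrArg (fun f : HeckeAlgebra (moduleSubgroup S M) => f.1 γ) hF
      replace h := (HeckeAlgebra.sum_apply _ _ _).symm.trans h
      rw [Finset.sum_eq_single t] at h
      · exact h
      · intro u _ hu
        refine coeffHom_mul_denIsometry_apply u _ fun h1 => hu ?_
        exact toFractionGroup_injective hS (h1.symm.trans hγ)
      · intro h1
        rw [Finsupp.notMem_support_iff.mp h1]
        change (coeffHom S M 0 * denIsometry S M t).1 γ = 0
        rw [map_zero, zero_mul, HeckeAlgebra.zero_apply]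
    · exact coeffHom_mul_denIsometry_apply t _ hγ

/-- The crossed product of the group *-algebra is the Hecke algebra. -/
noncomputable def heckeEquiv (hS : S ≤ nonZeroDivisors R) :
    StarCrossedProduct (coeffAction S M) ≃⋆ₐ[ℂ] HeckeAlgebra (moduleSubgroup S M) :=
  StarAlgEquiv.ofBijective (toHecke S M) ⟨toHecke_injective hS, toHecke_surjective⟩

end HeckeIsomorphism

/-! ### The universal property of the enveloping C*-algebra. -/

namespace CStarEnvelope

variable {A : Type*} [Ring A] [StarRing A] [Algebra ℂ A]

/-- The C*-seminorm `a ↦ ‖φ a‖` of a *-homomorphism to a C*-algebra. -/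
noncomputable def _root_.CStarSeminorm.ofHom {D : Type*} [CStarAlgebra D] (φ : A →⋆ₙₐ[ℂ] D) :
    CStarSeminorm A where
  toFun a := ‖φ a‖
  map_zero' := by rw [map_zero, norm_zero]
  add_le' a b := by rw [map_add]; exact norm_add_le _ _
  neg' a := by rw [map_neg, norm_neg]
  smul' c a := by rw [map_smul, norm_smul]
  mul_le' a b := by rw [map_mul]; exact norm_mul_le _ _
  cstar' a := by rw [map_mul, map_star, CStarRing.norm_star_mul_self]

variable [StarModule ℂ A] [HasCStarEnvelope A] {D : Type*} [CStarAlgebra D]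

/-- The function a ↦ ‖φ a‖ is itself a C*-seminorm, hence lies below the greatest one. This is what
allows φ to be extended by continuity. -/
theorem norm_hom_le (φ : A →⋆ₙₐ[ℂ] D) (a : A) : ‖φ a‖ ≤ ‖ofAlg A a‖ := by
  refine (le_ciSup (HasCStarEnvelope.bddAbove a) (CStarSeminorm.ofHom φ)).trans ?_
  exact ((CStarSeminorm.sup A).norm_toCompletion a).ge

theorem denseRange_ofAlg : DenseRange (ofAlg A) := (CStarSeminorm.sup A).denseRange_toCompletion

/-- The extension of `φ : A → D` to the enveloping C*-algebra, as a function. -/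
noncomputable def extendFun (φ : A →⋆ₙₐ[ℂ] D) : CStarEnvelope A → D :=
  UniformSpace.Completion.extension (show (CStarSeminorm.sup A).Pre → D from φ)

theorem uniformContinuous_pre (φ : A →⋆ₙₐ[ℂ] D) :
    UniformContinuous (show (CStarSeminorm.sup A).Pre → D from φ) := by
  refine LipschitzWith.uniformContinuous (K := 1) (LipschitzWith.of_dist_le_mul fun a b => ?_)
  rw [NNReal.coe_one, one_mul, dist_eq_norm, dist_eq_norm]
  rw [show φ a - φ b = φ (show A from a - b) from (map_sub φ (show A from a) b).symm]
  exact (norm_hom_le φ _).trans ((CStarSeminorm.sup A).norm_toCompletion _).le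

theorem continuous_extendFun (φ : A →⋆ₙₐ[ℂ] D) : Continuous (extendFun φ) :=
  UniformSpace.Completion.continuous_extension

theorem extendFun_ofAlg (φ : A →⋆ₙₐ[ℂ] D) (a : A) : extendFun φ (ofAlg A a) = φ a :=
  UniformSpace.Completion.extension_coe (uniformContinuous_pre φ) a

/-- The extension of `φ : A → D` to the enveloping C*-algebra. -/
noncomputable def extend (φ : A →⋆ₙₐ[ℂ] D) : CStarEnvelope A →⋆ₙₐ[ℂ] D where
  toFun := extendFun φ
  map_smul' c x := by
    have hc := continuous_extendFun φ
    refine denseRange_ofAlg.induction_on x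
      (isClosed_eq (hc.comp (continuous_const_smul c)) (hc.const_smul c)) fun a => ?_
    rw [← map_smul, extendFun_ofAlg, map_smul, extendFun_ofAlg, MonoidHom.id_apply]
  map_zero' := by rw [← map_zero (ofAlg A), extendFun_ofAlg, map_zero]
  map_add' x y := by
    have hc := continuous_extendFun φ
    refine denseRange_ofAlg.induction_on₂ (isClosed_eq (hc.comp continuous_add)
      ((hc.comp continuous_fst).add (hc.comp continuous_snd))) (fun a b => ?_) x y
    rw [← map_add, extendFun_ofAlg, map_add, extendFun_ofAlg, extendFun_ofAlg]
  map_mul' x y := by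
    have hc := continuous_extendFun φ
    refine denseRange_ofAlg.induction_on₂ (isClosed_eq (hc.comp continuous_mul)
      ((hc.comp continuous_fst).mul (hc.comp continuous_snd))) (fun a b => ?_) x y
    rw [← map_mul, extendFun_ofAlg, map_mul, extendFun_ofAlg, extendFun_ofAlg]
  map_star' x := by
    have hc := continuous_extendFun φ
    refine denseRange_ofAlg.induction_on x (isClosed_eq (hc.comp continuous_star) hc.star)
      fun a => ?_
    rw [← map_star, extendFun_ofAlg, map_star, extendFun_ofAlg]

theorem extend_ofAlg (φ : A →⋆ₙₐ[ℂ] D) (a : A) : extend φ (ofAlg A a) = φ a :=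
  extendFun_ofAlg φ a

/-- The extension of a unital `φ : A → D` to the enveloping C*-algebra. -/
noncomputable def extendUnital (φ : A →⋆ₐ[ℂ] D) : CStarEnvelope A →⋆ₐ[ℂ] D where
  toFun := extend (φ : A →⋆ₙₐ[ℂ] D)
  map_one' := by
    rw [← map_one (ofAlg A), extend_ofAlg]
    exact map_one φ
  map_mul' := map_mul _
  map_zero' := map_zero _
  map_add' := map_add _
  commutes' c := by
    rw [Algebra.algebraMap_eq_smul_one, map_smul, ← map_one (ofAlg A), extend_ofAlg,
      Algebra.algebraMap_eq_smul_one]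
    exact congrArg _ (map_one φ)
  map_star' := map_star _

theorem extendUnital_ofAlg (φ : A →⋆ₐ[ℂ] D) (a : A) : extendUnital φ (ofAlg A a) = φ a :=
  extend_ofAlg (φ : A →⋆ₙₐ[ℂ] D) a

theorem continuous_hom {E : Type*} [CStarAlgebra E] (φ : E →⋆ₙₐ[ℂ] D) : Continuous φ :=
  AddMonoidHomClass.continuous_of_bound φ 1 fun x => by
    rw [one_mul]
    exact NonUnitalStarAlgHom.norm_apply_le φ x

theorem hom_ext {φ ψ : CStarEnvelope A →⋆ₙₐ[ℂ] D} (h : ∀ a, φ (ofAlg A a) = ψ (ofAlg A a)) :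
    φ = ψ := by
  ext x
  exact denseRange_ofAlg.induction_on x (isClosed_eq (continuous_hom φ) (continuous_hom ψ)) h

theorem hom_ext_unital {φ ψ : CStarEnvelope A →⋆ₐ[ℂ] D}
    (h : ∀ a, φ (ofAlg A a) = ψ (ofAlg A a)) : φ = ψ := by
  ext x
  exact DFunLike.congr_fun (hom_ext (φ := (φ : CStarEnvelope A →⋆ₙₐ[ℂ] D)) (ψ := ψ) h) x

/-! ### Enveloping C*-algebras commute with semigroup crossed products. -/

section Action

variable {S : Type*} [Monoid S] (α : S →* (A →⋆ₙₐ[ℂ] A))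

/-- The extension of an action on `A` to its enveloping C*-algebra. -/
noncomputable def extendAction : S →* (CStarEnvelope A →⋆ₙₐ[ℂ] CStarEnvelope A) where
  -- The non-unital extension is needed, because α_s(1) need not be 1.
  toFun s := extend ((ofAlg A : A →⋆ₙₐ[ℂ] CStarEnvelope A).comp (α s))
  map_one' := by
    refine hom_ext fun a => ?_
    rw [extend_ofAlg, map_one]
    rfl
  map_mul' s t := by
    refine hom_ext fun a => ?_
    rw [extend_ofAlg, map_mul]
    change ofAlg A (α s (α t a)) = extend _ (extend _ (ofAlg A a))
    rw [extend_ofAlg]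
    change _ = extend _ (ofAlg A (α t a))
    rw [extend_ofAlg]
    rfl

theorem extendAction_ofAlg (s : S) (a : A) :
    extendAction α s (ofAlg A a) = ofAlg A (α s a) := extend_ofAlg _ a

variable {α} {B : Type*} [Ring B] [StarRing B] [Algebra ℂ B] [StarModule ℂ B] [HasCStarEnvelope B]

/-- The homomorphism from the crossed product of the enveloping C*-algebra of `A` to the enveloping
C*-algebra of the crossed product of `A`. -/
noncomputable def ofCrossedProduct (e : StarCrossedProduct α ≃⋆ₐ[ℂ] B) :
    CStarCrossedProduct (extendAction α) →⋆ₐ[ℂ] CStarEnvelope B :=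
  extendUnital (StarCrossedProduct.lift (extendAction α)
    (extendUnital ((ofAlg B).comp ((e : StarCrossedProduct α →⋆ₐ[ℂ] B).comp
      (StarCrossedProduct.coeff α))))
    (((ofAlg B).comp (e : StarCrossedProduct α →⋆ₐ[ℂ] B) : StarCrossedProduct α →* CStarEnvelope B).comp
      (StarCrossedProduct.iso α))
    (fun s => by
      change star (ofAlg B (e (StarCrossedProduct.iso α s))) *
        ofAlg B (e (StarCrossedProduct.iso α s)) = 1
      rw [← map_star, ← map_star, ← map_mul, ← map_mul, StarCrossedProduct.star_iso_mul_iso,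
        map_one, map_one])
    (fun s x => by
      change extendUnital _ (extendAction α s x) = ofAlg B (e (StarCrossedProduct.iso α s)) *
        extendUnital _ x * star (ofAlg B (e (StarCrossedProduct.iso α s)))
      -- Both sides of the covariance relation are continuous in x, so it suffices to verify it on
      -- the dense image of `A`, where it is the relation in A ⋊ S.
      have hc := continuous_hom (D := CStarEnvelope B) (E := CStarEnvelope A)
        (extendUnital ((ofAlg B).comp ((e : StarCrossedProduct α →⋆ₐ[ℂ] B).comp
          (StarCrossedProduct.coeff α))) : CStarEnvelope A →⋆ₙₐ[ℂ] CStarEnvelope B)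
      refine denseRange_ofAlg.induction_on x (isClosed_eq
        (hc.comp (continuous_hom (extendAction α s))) ((hc.const_mul _).mul_const _)) fun a => ?_
      rw [extendAction_ofAlg, extendUnital_ofAlg, extendUnital_ofAlg]
      change ofAlg B (e (StarCrossedProduct.coeff α (α s a))) = _ * ofAlg B (e _) * _
      rw [StarCrossedProduct.covariance, map_mul, map_mul, map_star, map_mul, map_mul, map_star]
      rfl))

theorem ofCrossedProduct_coeff (e : StarCrossedProduct α ≃⋆ₐ[ℂ] B) (a : A) :
    ofCrossedProduct e (CStarCrossedProduct.coeff _ (ofAlg A a)) =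
      ofAlg B (e (StarCrossedProduct.coeff α a)) := by
  refine (extendUnital_ofAlg _ _).trans ?_
  exact (StarCrossedProduct.lift_coeff _ _ _).trans (extendUnital_ofAlg _ _)

theorem ofCrossedProduct_iso (e : StarCrossedProduct α ≃⋆ₐ[ℂ] B) (s : S) :
    ofCrossedProduct e (CStarCrossedProduct.iso _ s) =
      ofAlg B (e (StarCrossedProduct.iso α s)) := by
  refine (extendUnital_ofAlg _ _).trans ?_
  rw [StarCrossedProduct.lift_iso]
  rfl

/-- The inverse of `ofCrossedProduct`. -/
noncomputable def toCrossedProduct (e : StarCrossedProduct α ≃⋆ₐ[ℂ] B) :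
    CStarEnvelope B →⋆ₐ[ℂ] CStarCrossedProduct (extendAction α) :=
  extendUnital ((StarCrossedProduct.lift α
    ((CStarCrossedProduct.coeff (extendAction α)).comp (ofAlg A))
    ((ofAlg (StarCrossedProduct (extendAction α)) : _ →* CStarCrossedProduct (extendAction α)).comp
      (StarCrossedProduct.iso (extendAction α)))
    (fun s => by
      change star (ofAlg _ _) * ofAlg _ _ = 1
      rw [← map_star, ← map_mul, StarCrossedProduct.star_iso_mul_iso, map_one])
    (fun s a => by
      change ofAlg _ (StarCrossedProduct.coeff _ (ofAlg A (α s a))) =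
        ofAlg _ _ * ofAlg _ (StarCrossedProduct.coeff _ (ofAlg A a)) * star (ofAlg _ _)
      rw [← extendAction_ofAlg, StarCrossedProduct.covariance, map_mul, map_mul, map_star])).comp
    (e.symm : B →⋆ₐ[ℂ] StarCrossedProduct α))

theorem toCrossedProduct_coeff (e : StarCrossedProduct α ≃⋆ₐ[ℂ] B) (a : A) :
    toCrossedProduct e (ofAlg B (e (StarCrossedProduct.coeff α a))) =
      CStarCrossedProduct.coeff _ (ofAlg A a) := by
  refine (extendUnital_ofAlg _ _).trans ?_
  change StarCrossedProduct.lift _ _ _ _ _ (e.symm (e _)) = _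
  rw [StarAlgEquiv.symm_apply_apply, StarCrossedProduct.lift_coeff]
  rfl

theorem toCrossedProduct_iso (e : StarCrossedProduct α ≃⋆ₐ[ℂ] B) (s : S) :
    toCrossedProduct e (ofAlg B (e (StarCrossedProduct.iso α s))) =
      CStarCrossedProduct.iso _ s := by
  refine (extendUnital_ofAlg _ _).trans ?_
  change StarCrossedProduct.lift _ _ _ _ _ (e.symm (e _)) = _
  rw [StarAlgEquiv.symm_apply_apply, StarCrossedProduct.lift_iso]
  rfl

/-- It is enough to compare generators. Density is used twice: for the crossed product in its
envelope, and for `A` in the C*-algebra of coefficients. -/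
theorem toCrossedProduct_comp (e : StarCrossedProduct α ≃⋆ₐ[ℂ] B) :
    (toCrossedProduct e).comp (ofCrossedProduct e) = StarAlgHom.id ℂ _ := by
  refine hom_ext_unital fun z => ?_
  refine DFunLike.congr_fun (StarCrossedProduct.hom_ext
    (φ := ((toCrossedProduct e).comp (ofCrossedProduct e)).comp (ofAlg _))
    (ψ := ofAlg _) (fun x => ?_) fun s => ?_) z
  · refine DFunLike.congr_fun (hom_ext_unital
      (φ := ((toCrossedProduct e).comp (ofCrossedProduct e)).comp (CStarCrossedProduct.coeff _))
      (ψ := CStarCrossedProduct.coeff _) fun a => ?_) x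
    change toCrossedProduct e (ofCrossedProduct e (CStarCrossedProduct.coeff _ (ofAlg A a))) = _
    rw [ofCrossedProduct_coeff, toCrossedProduct_coeff]
  · change toCrossedProduct e (ofCrossedProduct e (CStarCrossedProduct.iso _ s)) =
      CStarCrossedProduct.iso _ s
    rw [ofCrossedProduct_iso, toCrossedProduct_iso]

theorem ofCrossedProduct_comp (e : StarCrossedProduct α ≃⋆ₐ[ℂ] B) :
    (ofCrossedProduct e).comp (toCrossedProduct e) = StarAlgHom.id ℂ _ := by
  refine hom_ext_unital fun b => ?_
  obtain ⟨z, rfl⟩ := e.surjective b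
  refine DFunLike.congr_fun (StarCrossedProduct.hom_ext
    (φ := ((ofCrossedProduct e).comp (toCrossedProduct e)).comp
      ((ofAlg B).comp (e : StarCrossedProduct α →⋆ₐ[ℂ] B)))
    (ψ := (ofAlg B).comp (e : StarCrossedProduct α →⋆ₐ[ℂ] B)) (fun a => ?_) fun s => ?_) z
  · change ofCrossedProduct e (toCrossedProduct e (ofAlg B (e (StarCrossedProduct.coeff α a)))) =
      ofAlg B (e (StarCrossedProduct.coeff α a))
    rw [toCrossedProduct_coeff, ofCrossedProduct_coeff]
  · change ofCrossedProduct e (toCrossedProduct e (ofAlg B (e (StarCrossedProduct.iso α s)))) =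
      ofAlg B (e (StarCrossedProduct.iso α s))
    rw [toCrossedProduct_iso, ofCrossedProduct_iso]

/-- The crossed product of the enveloping C*-algebra of `A` is the enveloping C*-algebra of the
crossed product of `A`. -/
noncomputable def crossedProductEquiv (e : StarCrossedProduct α ≃⋆ₐ[ℂ] B) :
    CStarCrossedProduct (extendAction α) ≃⋆ₐ[ℂ] CStarEnvelope B :=
  StarAlgEquiv.ofStarAlgHom (ofCrossedProduct e) (toCrossedProduct e) (toCrossedProduct_comp e)
    (ofCrossedProduct_comp e)

end Action

end CStarEnvelope

/-! ### Existence of enveloping C*-algebras. -/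

namespace HasCStarEnvelope

variable {A : Type*} [Ring A] [StarRing A] [Algebra ℂ A]

/-- The C*-seminorm `a ↦ p (φ a)`. -/
noncomputable def _root_.CStarSeminorm.comp {B : Type*} [Ring B] [StarRing B] [Algebra ℂ B]
    (p : CStarSeminorm B) (φ : A →⋆ₐ[ℂ] B) : CStarSeminorm A where
  toFun a := p.toSeminorm (φ a)
  map_zero' := by rw [map_zero, map_zero]
  add_le' a b := by rw [map_add]; exact map_add_le_add _ _ _
  neg' a := by rw [map_neg, map_neg_eq_map]
  smul' c a := by rw [map_smul, map_smul_eq_mul]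
  mul_le' a b := by rw [map_mul]; exact p.mul_le' _ _
  cstar' a := by rw [map_mul, map_star]; exact p.cstar' _

/-- C*-seminorms on `B` pull back along φ to C*-seminorms on `A`, so a bound for `a` also bounds `φ
a`. -/
theorem bddAbove_map [HasCStarEnvelope A] {B : Type*} [Ring B] [StarRing B] [Algebra ℂ B]
    (φ : A →⋆ₐ[ℂ] B) (a : A) :
    BddAbove (Set.range fun p : CStarSeminorm B => p.toSeminorm (φ a)) := by
  obtain ⟨C, hC⟩ := HasCStarEnvelope.bddAbove a
  refine ⟨C, ?_⟩
  rintro _ ⟨p, rfl⟩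
  exact hC ⟨p.comp φ, rfl⟩

theorem of_surjective [HasCStarEnvelope A] {B : Type*} [Ring B] [StarRing B] [Algebra ℂ B]
    (φ : A →⋆ₐ[ℂ] B) (hφ : Function.Surjective φ) : HasCStarEnvelope B where
  bddAbove b := by
    obtain ⟨a, rfl⟩ := hφ b
    exact bddAbove_map φ a

/-- The generators are bounded: coefficients by transport from `A`, isometries and their adjoints by
1. The coefficient algebra need not be a C*-algebra, so this covers ℂ(N/Γ₀). -/
theorem starCrossedProduct [HasCStarEnvelope A] {S : Type*} [Monoid S]
    (α : S →* (A →⋆ₙₐ[ℂ] A)) : HasCStarEnvelope (StarCrossedProduct α) where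
  bddAbove z := by
    induction z using StarCrossedProduct.induction_left with
    | one => exact CStarSeminorm.bddAbove_isometry (by rw [star_one, one_mul])
    | add x y hx hy => exact CStarSeminorm.bddAbove_add hx hy
    | coeff_mul a x hx => exact CStarSeminorm.bddAbove_mul (bddAbove_map _ a) hx
    | iso_mul s x hx =>
      exact CStarSeminorm.bddAbove_mul
        (CStarSeminorm.bddAbove_isometry (StarCrossedProduct.star_iso_mul_iso α s)) hx
    | star_iso_mul s x hx =>
      exact CStarSeminorm.bddAbove_mul (CStarSeminorm.bddAbove_star
        (CStarSeminorm.bddAbove_isometry (StarCrossedProduct.star_iso_mul_iso α s))) hx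

end HasCStarEnvelope

/-! ### Assembly of the three statements. -/

theorem mainTheorem8 {R : Type*} [CommRing R] {M : Type*} [AddCommGroup M] [Module R M]
    (S : Submonoid R) (hS : S ≤ nonZeroDivisors R)
    (hfin : ∀ s : S, Finite (InvQuotient S M s)) :
    ∃ _ : IsHeckePair (moduleSubgroup S M),
      (∃ α : S →* (GroupStarAlgebra (FractionQuotient S M) →⋆ₙₐ[ℂ]
            GroupStarAlgebra (FractionQuotient S M)),
        (∀ (s : S) (x : FractionQuotient S M),
          α s (GroupStarAlgebra.e x) = (Nat.card (InvQuotient S M s) : ℂ)⁻¹ •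
            ∑ᶠ y ∈ {y : FractionQuotient S M | (s : R) • y = x},
              GroupStarAlgebra.e y) ∧
        ∃ Φ : StarCrossedProduct α ≃⋆ₐ[ℂ] HeckeAlgebra (moduleSubgroup S M),
          (∀ n : LocalizedModule S M,
            Φ (StarCrossedProduct.coeff α
                (GroupStarAlgebra.e (fractionClass S M n))) =
              HeckeAlgebra.char (moduleSubgroup S M)
                (SemidirectProduct.inl (Multiplicative.ofAdd n))) ∧
          (∀ s : S, Φ (StarCrossedProduct.iso α s) =
            (((√(Nat.card (InvQuotient S M s)))⁻¹ : ℝ) : ℂ) •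
              HeckeAlgebra.char (moduleSubgroup S M)
                (SemidirectProduct.inr (toFractionGroup S s)))) ∧
      ∃ _ : HasCStarEnvelope (HeckeAlgebra (moduleSubgroup S M)),
      ∃ β : S →* (GroupCStarAlgebra (FractionQuotient S M) →⋆ₙₐ[ℂ]
            GroupCStarAlgebra (FractionQuotient S M)),
        (∀ (s : S) (x : FractionQuotient S M),
          β s (GroupCStarAlgebra.e x) = (Nat.card (InvQuotient S M s) : ℂ)⁻¹ •
            ∑ᶠ y ∈ {y : FractionQuotient S M | (s : R) • y = x},
              GroupCStarAlgebra.e y) ∧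
        ∃ Ψ : CStarCrossedProduct β ≃⋆ₐ[ℂ] CStarEnvelope (HeckeAlgebra (moduleSubgroup S M)),
          (∀ n : LocalizedModule S M,
            Ψ (CStarCrossedProduct.coeff β
                (GroupCStarAlgebra.e (fractionClass S M n))) =
              CStarEnvelope.ofAlg _ (HeckeAlgebra.char (moduleSubgroup S M)
                (SemidirectProduct.inl (Multiplicative.ofAdd n)))) ∧
          (∀ s : S, Ψ (CStarCrossedProduct.iso β s) =
            (((√(Nat.card (InvQuotient S M s)))⁻¹ : ℝ) : ℂ) •
              CStarEnvelope.ofAlg _ (HeckeAlgebra.char (moduleSubgroup S M)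
                (SemidirectProduct.inr (toFractionGroup S s)))) := by
  have := isHeckePair_moduleSubgroup hfin
  have := HasCStarEnvelope.starCrossedProduct (coeffAction S M)
  -- Bounds on C*-seminorms pass to quotients, so surjectivity of `toHecke` alone gives the envelope
  -- of the Hecke algebra.
  have henv : HasCStarEnvelope (HeckeAlgebra (moduleSubgroup S M)) :=
    HasCStarEnvelope.of_surjective (toHecke S M) toHecke_surjective
  have hcoeff : ∀ n : LocalizedModule S M, heckeEquiv hS (StarCrossedProduct.coeff
      (coeffAction S M) (GroupStarAlgebra.e (fractionClass S M n))) =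
        HeckeAlgebra.char (moduleSubgroup S M)
          (SemidirectProduct.inl (Multiplicative.ofAdd n)) := fun n =>
    (toHecke_coeff _).trans (coeffHom_e n)
  have hiso : ∀ s : S, heckeEquiv hS (StarCrossedProduct.iso (coeffAction S M) s) =
      (((√(Nat.card (InvQuotient S M s)))⁻¹ : ℝ) : ℂ) • HeckeAlgebra.char (moduleSubgroup S M)
        (SemidirectProduct.inr (toFractionGroup S s)) := fun s =>
    (toHecke_iso s).trans (denIsometry_apply s)
  refine ⟨inferInstance, ⟨coeffAction S M, fun s x => (coeffAction_e s x).2, heckeEquiv hS,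
    hcoeff, hiso⟩, henv, CStarEnvelope.extendAction (coeffAction S M), fun s x => ?_,
    CStarEnvelope.crossedProductEquiv (heckeEquiv hS), fun n => ?_, fun s => ?_⟩
  -- Finiteness of {y | sy = x} turns the `finsum` into a finite sum, which the homomorphism into
  -- the envelope respects.
  · obtain ⟨hf, h⟩ := coeffAction_e s x
    rw [GroupCStarAlgebra.e, CStarEnvelope.extendAction_ofAlg, h, map_smul,
      finsum_mem_eq_finite_toFinset_sum _ hf, finsum_mem_eq_finite_toFinset_sum _ hf, map_sum]
    rfl
  · refine (CStarEnvelope.ofCrossedProduct_coeff _ _).trans ?_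
    rw [hcoeff]
  · refine (CStarEnvelope.ofCrossedProduct_iso _ _).trans ?_
    rw [hiso, map_smul]
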